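/- Let $k\ge 2$ be an integer. For a finite simple graph $G$, let $\chi'_k(G)$ (the mod $k$ chromatic index) be the minimum number of colours in a colouring of the edges of $G$ (adjacent edges may receive the same colour) such that, for every colour, each vertex incident with at least one edge of that colour is incident with a number of edges of that colour that is congruent to $1$ modulo $k$. Let $G(n,p)$ be the binomial random graph on $n$ vertices, in which every pair of vertices is an edge independently with probability $p$. Theorem. For every integer $k\ge 2$ there is a constant $C_k>0$, depending only on $k$, such that the following holds for every sequence $p=p(n)\in[0,1]$ with $p(n)\ge C_k\,n^{-1}\log n$ for all sufficiently large $n$ and $n(1-p(n))\to\infty$ as $n\to\infty$. (i) If $k$ is even, then $$\lim_{n\to\infty}\mathbb{P}\big(\chi'_k(G(2n,p(2n)))=k\big)=1\quad\text{and}\quad \lim_{n\to\infty}\mathbb{P}\big(\chi'_k(G(2n+1,p(2n+1)))=k+1\big)=1.$$ (ii) If $k$ is odd, then $$\lim_{n\to\infty}\mathbb{P}\big(\chi'_k(G(n,p(n)))=k\big)=1.$$ -/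

import Mathlib

namespace SimpleGraph

variable {V : Type*}

/-- An edge colouring `c` of `G` is a mod `k` colouring if, for every colour `i`, the subgraph
spanned by the edges of colour `i` has all degrees congruent to `1` modulo `k`. The vertices of
that subgraph are the endpoints of the edges of colour `i`, that is, the vertices `v` at which
`c.labelGraph i` has at least one neighbour. -/
def IsModColoring {G : SimpleGraph V} {K : Type*} (k : ℕ) (c : G.EdgeLabeling K) : Prop :=
  ∀ (i : K) (v : V), ((c.labelGraph i).neighborSet v).Nonempty →
    ((c.labelGraph i).neighborSet v).ncard ≡ 1 [MOD k]

/-- `G` has a mod `k` edge colouring with the `r` colours `0, …, r - 1`. -/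
def ModEdgeColorable (G : SimpleGraph V) (k r : ℕ) : Prop :=
  ∃ c : G.EdgeLabeling (Fin r), IsModColoring k c

/-- The mod `k` chromatic index: the least number of colours in a mod `k` edge colouring of `G`
(`⊤` if there is none with finitely many colours, which cannot happen for a finite graph). -/
noncomputable def modChromaticIndex (G : SimpleGraph V) (k : ℕ) : ℕ∞ :=
  ⨅ r ∈ {r : ℕ | G.ModEdgeColorable k r}, (r : ℕ∞)

end SimpleGraph

/-! In a mod `k` colouring the degree of a vertex is congruent modulo `k` to the number of colours
it sees. Both bounds rest on this and on one property of the random graph: every vertex has many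
neighbours in every degree class modulo `k`.

Lower bounds. A non-isolated vertex of degree 0 modulo `k` sees a positive multiple of `k` colours.
If `k` is even, the order is odd and there are only `k` colours, then each vertex of degree 1 modulo
`k` sees exactly one colour. These vertices induce a connected graph, so their colour is common, and
every vertex has a neighbour among them. Hence all vertices have odd degree in that colour, against
the handshake lemma.

Upper bounds. Let `s v` be the residue of `deg v - 1` in `[0, k)`. Choose `k - 1` vertex sets `T i`
so that `v` lies in exactly `s v` of them, and remove edge-disjoint subgraphs `F i` that span `T i`
with degrees 1 modulo `k`; what remains has degrees 1 modulo `k` and is the last colour. Vertices of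
degree 0 modulo `k` have `s v = k - 1` and lie in every `T i`, so every vertex has many neighbours
in `T i`, and Tutte's theorem gives a perfect matching when `T i` has even size. For odd `k` an odd
`T i` is repaired by one star with `k + 1` leaves. For even `k` the sets are chosen even, which is
possible when the order is even. If `k` is even and the order odd, the star of a vertex of degree 1
modulo `k` is an extra colour, and an even number of vertices is left.

Probability. `PseudoRandom` collects what is used, with `d` of order `np`, `m` of order `n` and `Δ`
constant. The degree classes are handled by characters of `ZMod k`, which requires `np(1 - p)`
large; edge counts are Chernoff bounds, and `np ≥ C log n` pays for the union bounds. Everything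
after `exists_tendsto_binomialRandom_of_pseudoRandom` is deterministic. -/

section

open scoped Classical

/-! ### Averages over independent bits. -/

section BernoulliMean

variable {ι : Type*} [Fintype ι] {R : Type*} [CommRing R]

/-- The mean of `f ω` when the bits `ω i` are independent, each being `true` with probability
`p`. -/
noncomputable def bernoulliMean (p : R) (f : (ι → Bool) → R) : R :=
  ∑ ω, (∏ i, if ω i then p else 1 - p) * f ω

theorem bernoulliMean_prod (p : R) (g : ι → Bool → R) :
    bernoulliMean p (fun ω => ∏ i, g i (ω i)) = ∏ i, (p * g i true + (1 - p) * g i false) := by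
  have h : ∀ i, p * g i true + (1 - p) * g i false
      = ∑ b : Bool, (if b then p else 1 - p) * g i b := by
    intro i; simp
  simp_rw [h, Fintype.prod_sum, bernoulliMean, Finset.prod_mul_distrib]

theorem bernoulliMean_const (p c : R) : bernoulliMean p (fun _ : ι → Bool => c) = c := by
  have h := bernoulliMean_prod (ι := ι) p (fun _ _ => 1)
  simp only [Finset.prod_const_one, mul_one, add_sub_cancel] at h
  rw [bernoulliMean] at h ⊢
  rw [← Finset.sum_mul]
  simp only [mul_one] at h
  rw [h, one_mul]

theorem bernoulliMean_const_mul (p c : R) (f : (ι → Bool) → R) :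
    bernoulliMean p (fun ω => c * f ω) = c * bernoulliMean p f := by
  simp only [bernoulliMean, Finset.mul_sum]
  exact Finset.sum_congr rfl fun ω _ => by ring

theorem bernoulliMean_sum {α : Type*} (p : R) (s : Finset α) (f : α → (ι → Bool) → R) :
    bernoulliMean p (fun ω => ∑ a ∈ s, f a ω) = ∑ a ∈ s, bernoulliMean p (f a) := by
  simp only [bernoulliMean, Finset.mul_sum]
  exact Finset.sum_comm

theorem bernoulliMean_sub (p : R) (f g : (ι → Bool) → R) :
    bernoulliMean p (fun ω => f ω - g ω) = bernoulliMean p f - bernoulliMean p g := by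
  simp only [bernoulliMean, mul_sub, Finset.sum_sub_distrib]

/-- Replace the bits of `ω` in `D` by those of `η`. -/
noncomputable def resample (D : Set ι) (η ω : ι → Bool) : ι → Bool :=
  fun i => if i ∈ D then η i else ω i

omit [Fintype ι] in
theorem resample_of_mem {D : Set ι} {i : ι} (h : i ∈ D) (η ω : ι → Bool) :
    resample D η ω i = η i := if_pos h

omit [Fintype ι] in
theorem resample_of_notMem {D : Set ι} {i : ι} (h : i ∉ D) (η ω : ι → Bool) :
    resample D η ω i = ω i := if_neg h

/-- Exchanging the bits in `D` between two independent copies is a weight-preserving involution on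
pairs. This replaces conditioning: one block of bits is averaged while the others are frozen. -/
theorem bernoulliMean_resample (p : R) (D : Set ι) (f : (ι → Bool) → R) :
    bernoulliMean p (fun ω => bernoulliMean p (fun η => f (resample D η ω)))
      = bernoulliMean p f := by
  have key : ∀ F : ((ι → Bool) × (ι → Bool)) → R,
      ∑ x : (ι → Bool) × (ι → Bool), F (resample D x.1 x.2, resample D x.2 x.1) = ∑ x, F x := by
    intro F
    refine Function.Bijective.sum_comp
      (e := fun x => (resample D x.1 x.2, resample D x.2 x.1))
      (Function.Involutive.bijective fun x => ?_) F
    ext i <;> simp only [resample] <;> split_ifs <;> rfl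
  have hw : ∀ η ω : ι → Bool, (∏ i, if resample D η ω i then p else 1 - p) *
      (∏ i, if resample D ω η i then p else 1 - p)
      = (∏ i, if η i then p else 1 - p) * ∏ i, if ω i then p else 1 - p := by
    intro η ω
    rw [← Finset.prod_mul_distrib, ← Finset.prod_mul_distrib]
    refine Finset.prod_congr rfl fun i _ => ?_
    simp only [resample]
    split_ifs <;> ring
  have h1 : bernoulliMean p (fun ω => bernoulliMean p (fun η => f (resample D η ω)))
      = ∑ x : (ι → Bool) × (ι → Bool), (∏ i, if x.1 i then p else 1 - p) *
        (∏ i, if x.2 i then p else 1 - p) * f (resample D x.1 x.2) := by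
    rw [Fintype.sum_prod_type_right]
    simp only [bernoulliMean, Finset.mul_sum]
    exact Finset.sum_congr rfl fun ω _ => Finset.sum_congr rfl fun η _ => by ring
  have h2 := key (fun x => (∏ i, if x.1 i then p else 1 - p) *
        (∏ i, if x.2 i then p else 1 - p) * f x.1)
  simp only [hw] at h2
  rw [h1, h2, Fintype.sum_prod_type_right]
  have h3 : bernoulliMean p (fun _ : ι → Bool => bernoulliMean p f) = bernoulliMean p f :=
    bernoulliMean_const _ _
  rw [← h3]
  simp only [bernoulliMean, Finset.mul_sum]
  exact Finset.sum_congr rfl fun ω _ => Finset.sum_congr rfl fun η _ => by ring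

end BernoulliMean

/-! ### Probabilities, union bounds and exponential moments. -/

section BernoulliProb

variable {ι : Type*} [Fintype ι] {p : ℝ}

theorem bernoulli_weight_nonneg (hp0 : 0 ≤ p) (hp1 : p ≤ 1) (ω : ι → Bool) :
    0 ≤ ∏ i, if ω i then p else 1 - p :=
  Finset.prod_nonneg fun i _ => by split_ifs <;> linarith

theorem bernoulliMean_mono (hp0 : 0 ≤ p) (hp1 : p ≤ 1) {f g : (ι → Bool) → ℝ}
    (h : ∀ ω, f ω ≤ g ω) : bernoulliMean p f ≤ bernoulliMean p g :=
  Finset.sum_le_sum fun ω _ => mul_le_mul_of_nonneg_left (h ω) (bernoulli_weight_nonneg hp0 hp1 ω)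

/-- The probability of the event `Q` when the bits are independent, each being `true` with
probability `p`. -/
noncomputable def bernoulliProb (p : ℝ) (Q : (ι → Bool) → Prop) : ℝ :=
  bernoulliMean p (fun ω => if Q ω then 1 else 0)

theorem bernoulliProb_nonneg (hp0 : 0 ≤ p) (hp1 : p ≤ 1) (Q : (ι → Bool) → Prop) :
    0 ≤ bernoulliProb p Q :=
  Finset.sum_nonneg fun ω _ => mul_nonneg (bernoulli_weight_nonneg hp0 hp1 ω)
    (by dsimp only; split_ifs <;> norm_num)

theorem bernoulliProb_mono (hp0 : 0 ≤ p) (hp1 : p ≤ 1) {Q Q' : (ι → Bool) → Prop}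
    (h : ∀ ω, Q ω → Q' ω) : bernoulliProb p Q ≤ bernoulliProb p Q' := by
  refine bernoulliMean_mono hp0 hp1 fun ω => ?_
  by_cases hQ : Q ω
  · simp [hQ, h ω hQ]
  · simp only [hQ, if_false]; split_ifs <;> norm_num

theorem bernoulliProb_exists_le (hp0 : 0 ≤ p) (hp1 : p ≤ 1) {α : Type*} (s : Finset α)
    (Q : α → (ι → Bool) → Prop) :
    bernoulliProb p (fun ω => ∃ a ∈ s, Q a ω) ≤ ∑ a ∈ s, bernoulliProb p (Q a) := by
  simp only [bernoulliProb]
  rw [← bernoulliMean_sum]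
  refine bernoulliMean_mono hp0 hp1 fun ω => ?_
  split_ifs with h
  · obtain ⟨a, ha, hQ⟩ := h
    refine le_trans ?_ (Finset.single_le_sum
      (fun b _ => (by split_ifs <;> norm_num : (0 : ℝ) ≤ if Q b ω then 1 else 0)) ha)
    simp [hQ]
  · exact Finset.sum_nonneg fun b _ => by split_ifs <;> norm_num

theorem bernoulliProb_or_le (hp0 : 0 ≤ p) (hp1 : p ≤ 1) (Q Q' : (ι → Bool) → Prop) :
    bernoulliProb p (fun ω => Q ω ∨ Q' ω) ≤ bernoulliProb p Q + bernoulliProb p Q' := by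
  have h := bernoulliProb_exists_le hp0 hp1 (Finset.univ : Finset Bool)
    (fun b => if b then Q' else Q)
  simpa [add_comm] using h

theorem bernoulliProb_not (Q : (ι → Bool) → Prop) :
    bernoulliProb p (fun ω => ¬ Q ω) = 1 - bernoulliProb p Q := by
  have h := bernoulliMean_sub p (fun _ : ι → Bool => (1 : ℝ)) (fun ω => if Q ω then 1 else 0)
  rw [bernoulliMean_const] at h
  rw [bernoulliProb, bernoulliProb, ← h]
  congr 1
  ext ω
  split_ifs <;> norm_num

theorem bernoulliProb_le_exp_mul (hp0 : 0 ≤ p) (hp1 : p ≤ 1) (Z : (ι → Bool) → ℝ) (t : ℝ) :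
    bernoulliProb p (fun ω => t ≤ Z ω)
      ≤ Real.exp (-t) * bernoulliMean p (fun ω => Real.exp (Z ω)) := by
  rw [← bernoulliMean_const_mul]
  refine bernoulliMean_mono hp0 hp1 fun ω => ?_
  split_ifs with h
  · rw [← Real.exp_add]
    exact Real.one_le_exp (by linarith)
  · positivity

/-- If each `f a` does not depend on the bits in the blocks `D b` for `b ≠ a`, and averaging `f a`
over the bits in its own block `D a` always gives at most `c`, then the mean of the product is at
most `c ^ #s`. -/
theorem bernoulliMean_prod_le (hp0 : 0 ≤ p) (hp1 : p ≤ 1) {α : Type*} (s : Finset α)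
    (D : α → Set ι) (f : α → (ι → Bool) → ℝ) {c : ℝ} (hf : ∀ a ω, 0 ≤ f a ω)
    (hD : ∀ a ∈ s, ∀ b ∈ s, a ≠ b → ∀ η ω, f a (resample (D b) η ω) = f a ω)
    (hc : ∀ a ∈ s, ∀ ω, bernoulliMean p (fun η => f a (resample (D a) η ω)) ≤ c) :
    bernoulliMean p (fun ω => ∏ a ∈ s, f a ω) ≤ c ^ s.card := by
  induction s using Finset.induction_on with
  | empty => simp [bernoulliMean_const]
  | insert a s ha ih =>
    have hc0 : 0 ≤ c := by
      refine le_trans ?_ (hc a (Finset.mem_insert_self a s) fun _ => true)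
      exact Finset.sum_nonneg fun ω _ => mul_nonneg (bernoulli_weight_nonneg hp0 hp1 ω) (hf _ _)
    rw [← bernoulliMean_resample p (D a)]
    have h1 : ∀ ω, bernoulliMean p (fun η => ∏ b ∈ insert a s, f b (resample (D a) η ω))
        ≤ c * ∏ b ∈ s, f b ω := by
      intro ω
      have h2 : ∀ η, ∏ b ∈ insert a s, f b (resample (D a) η ω)
          = (∏ b ∈ s, f b ω) * f a (resample (D a) η ω) := by
        intro η
        rw [Finset.prod_insert ha, mul_comm]
        congr 1
        refine Finset.prod_congr rfl fun b hb => ?_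
        exact hD b (Finset.mem_insert_of_mem hb) a (Finset.mem_insert_self a s)
          (by rintro rfl; exact ha hb) η ω
      simp only [h2]
      rw [bernoulliMean_const_mul, mul_comm]
      exact mul_le_mul_of_nonneg_right (hc a (Finset.mem_insert_self a s) ω)
        (Finset.prod_nonneg fun b _ => hf b ω)
    refine (bernoulliMean_mono hp0 hp1 h1).trans ?_
    rw [bernoulliMean_const_mul, Finset.card_insert_of_notMem ha, pow_succ, mul_comm]
    refine mul_le_mul_of_nonneg_right (ih ?_ ?_) hc0
    · exact fun b hb d hd => hD b (Finset.mem_insert_of_mem hb) d (Finset.mem_insert_of_mem hd)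
    · exact fun b hb => hc b (Finset.mem_insert_of_mem hb)

end BernoulliProb

/-! ### The binomial random graph in terms of bits. -/

section RandomGraph

variable {V : Type*}

/-- The graph whose edges are the pairs whose bit is `true`. -/
def bitGraph (ω : Sym2 V → Bool) : SimpleGraph V :=
  SimpleGraph.fromEdgeSet {e | ω e = true}

theorem bitGraph_adj (ω : Sym2 V → Bool) (a b : V) :
    (bitGraph ω).Adj a b ↔ ω s(a, b) = true ∧ a ≠ b := by
  simp [bitGraph]

variable [Fintype V]

theorem bernoulliProb_bitGraph_eq (p : ℝ) (G : SimpleGraph V) :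
    bernoulliProb p (fun ω : Sym2 V → Bool => bitGraph ω = G)
      = p ^ G.edgeSet.ncard * (1 - p) ^ ((Nat.card V).choose 2 - G.edgeSet.ncard) := by
  -- Bits on the diagonal do not affect the graph, so their factor is constantly 1 and averages to
  -- 1.
  let g : Sym2 V → Bool → ℝ := fun e b => if e.IsDiag ∨ (b = true ↔ e ∈ G.edgeSet) then 1 else 0
  have h1 : ∀ ω : Sym2 V → Bool, (if bitGraph ω = G then (1 : ℝ) else 0) = ∏ e, g e (ω e) := by
    intro ω
    have h2 : bitGraph ω = G ↔ ∀ e : Sym2 V, e.IsDiag ∨ (ω e = true ↔ e ∈ G.edgeSet) := by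
      constructor
      · rintro rfl e
        by_cases he : e.IsDiag
        · exact Or.inl he
        · right
          simp [bitGraph, he]
      · intro h
        ext a b
        rw [bitGraph_adj]
        rcases h s(a, b) with h | h
        · simp only [Sym2.mk_isDiag_iff] at h
          simp [h]
        · rw [h, SimpleGraph.mem_edgeSet]
          exact ⟨fun h => h.1, fun h => ⟨h, h.ne⟩⟩
    simp only [g]
    rw [Finset.prod_ite_zero]
    simp [h2]
  simp only [bernoulliProb, h1]
  rw [bernoulliMean_prod]
  have h3 : ∀ e : Sym2 V, p * g e true + (1 - p) * g e false
      = (if e ∈ G.edgeFinset then p else 1)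
        * (if e ∈ (Finset.univ.filter fun e : Sym2 V => ¬ e.IsDiag) \ G.edgeFinset
            then 1 - p else 1) := by
    intro e
    have h4 : e ∈ G.edgeSet → ¬ e.IsDiag := fun h => G.not_isDiag_of_mem_edgeSet h
    by_cases h5 : e ∈ G.edgeSet
    · simp [g, h5, h4 h5]
    · by_cases h6 : e.IsDiag <;> simp [g, h5, h6]
  simp only [h3]
  rw [Finset.prod_mul_distrib, Finset.prod_ite_mem, Finset.prod_ite_mem, Finset.univ_inter,
    Finset.univ_inter, Finset.prod_const, Finset.prod_const]
  have h7 : G.edgeFinset ⊆ Finset.univ.filter fun e : Sym2 V => ¬ e.IsDiag := by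
    intro e he
    simpa using G.not_isDiag_of_mem_edgeSet (SimpleGraph.mem_edgeFinset.1 he)
  have h8 : (Finset.univ.filter fun e : Sym2 V => ¬ e.IsDiag).card = (Nat.card V).choose 2 := by
    rw [Nat.card_eq_fintype_card, ← Sym2.card_diagSet_compl, Fintype.card_subtype]
    congr 1
  rw [Finset.card_sdiff_of_subset h7, h8]
  have h9 : G.edgeSet.ncard = G.edgeFinset.card := by
    rw [← SimpleGraph.coe_edgeFinset, Set.ncard_coe_finset]
  rw [h9]

theorem binomialRandom_eq_bernoulliProb (p : unitInterval) (S : Set (SimpleGraph V)) :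
    SimpleGraph.binomialRandom V p S
      = ENNReal.ofReal (bernoulliProb (p : ℝ) fun ω : Sym2 V → Bool => bitGraph ω ∈ S) := by
  have : MeasurableSingletonClass (SimpleGraph V) := ⟨fun G => by
    rw [← SimpleGraph.measurableEmbedding_edgeSet.measurableSet_image, Set.image_singleton]
    exact measurableSet_singleton _⟩
  have h1 : SimpleGraph.binomialRandom V p S
      = ∑ G ∈ S.toFinset, SimpleGraph.binomialRandom V p {G} := by
    rw [MeasureTheory.sum_measure_singleton, Set.coe_toFinset]
  have h2 : ∀ G : SimpleGraph V, SimpleGraph.binomialRandom V p {G}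
      = ENNReal.ofReal (bernoulliProb (p : ℝ) fun ω : Sym2 V → Bool => bitGraph ω = G) := by
    intro G
    rw [SimpleGraph.binomialRandom_singleton, bernoulliProb_bitGraph_eq,
      ENNReal.ofReal_mul (pow_nonneg p.2.1 _), ENNReal.ofReal_pow p.2.1,
      ENNReal.ofReal_pow (by linarith [p.2.2])]
    congr 2
    · rw [ENNReal.ofReal]
      congr 1
      ext
      simp [Real.coe_toNNReal _ p.2.1]
    · rw [ENNReal.ofReal]
      congr 1
      ext
      rw [Real.coe_toNNReal _ (by linarith [p.2.2])]
      simp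
  rw [h1]
  simp only [h2]
  rw [← ENNReal.ofReal_sum_of_nonneg fun G _ => bernoulliProb_nonneg p.2.1 p.2.2 _]
  congr 1
  simp only [bernoulliProb]
  rw [← bernoulliMean_sum]
  congr 1
  ext ω
  simp

theorem bernoulliMean_coord {ι : Type*} [Fintype ι] (p : ℝ) (i : ι) (g : Bool → ℝ) :
    bernoulliMean p (fun ω : ι → Bool => g (ω i)) = p * g true + (1 - p) * g false := by
  have h := bernoulliMean_prod p (fun j b => if j = i then g b else 1)
  have h1 : ∀ j, p * (if j = i then g true else 1) + (1 - p) * (if j = i then g false else 1)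
      = if j = i then p * g true + (1 - p) * g false else 1 := by
    intro j; split_ifs <;> ring
  simp only [h1] at h
  simpa using h

/-- The Chernoff bound for a sum over a set of independent bits. -/
theorem bernoulliMean_exp_sum_le {ι : Type*} [Fintype ι] {p : ℝ} (hp0 : 0 ≤ p) (hp1 : p ≤ 1)
    (s : Finset ι) (x : ℝ) :
    bernoulliMean p (fun ω : ι → Bool => Real.exp (∑ i ∈ s, if ω i then x else 0))
      ≤ Real.exp (s.card * (p * (Real.exp x - 1))) := by
  have h := bernoulliMean_prod_le hp0 hp1 s (fun i => {i})
    (fun i ω => Real.exp (if ω i then x else 0)) (c := Real.exp (p * (Real.exp x - 1)))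
    (fun _ _ => (Real.exp_pos _).le) ?_ ?_
  · simp only [Real.exp_sum]
    refine h.trans_eq ?_
    rw [← Real.exp_nat_mul]
  · intro a _ b _ hab η ω
    simp [resample, hab]
  · intro a _ ω
    simp only [resample, Set.mem_singleton_iff, if_true]
    rw [bernoulliMean_coord p a (fun b => Real.exp (if b then x else 0))]
    simp only [if_true, Bool.false_eq_true, if_false, Real.exp_zero]
    refine le_trans (le_of_eq ?_) (Real.add_one_le_exp _)
    ring

end RandomGraph

/-! ### Equidistribution of binomial sums modulo `k`. -/

section Residue

theorem ofReal_bernoulliMean {ι : Type*} [Fintype ι] (p : ℝ) (f : (ι → Bool) → ℝ) :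
    ((bernoulliMean p f : ℝ) : ℂ) = bernoulliMean (p : ℂ) (fun ω => (f ω : ℂ)) := by
  simp only [bernoulliMean]
  push_cast
  refine Finset.sum_congr rfl fun ω _ => ?_
  congr 1
  refine Finset.prod_congr rfl fun i _ => ?_
  split_ifs <;> simp

/-- The squared norm equals `1 - 2p(1 - p)(1 - Re z)`, and `1 - x ≤ exp (-x)`. This bounds the
characteristic function of one bit. -/
theorem norm_one_sub_add_mul_le {p : ℝ} (hp0 : 0 ≤ p) (hp1 : p ≤ 1) {z : ℂ} (hz : ‖z‖ = 1)
    {c : ℝ} (hc : z.re ≤ 1 - c) :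
    ‖(1 - p + p * z : ℂ)‖ ≤ Real.exp (-(p * (1 - p) * c)) := by
  have h1 : z.re * z.re + z.im * z.im = 1 := by
    rw [← Complex.normSq_apply, Complex.normSq_eq_norm_sq, hz, one_pow]
  have h2 : ‖(1 - p + p * z : ℂ)‖ ^ 2 = 1 - 2 * (p * (1 - p)) * (1 - z.re) := by
    rw [← Complex.normSq_eq_norm_sq, Complex.normSq_apply]
    simp
    linear_combination p ^ 2 * h1
  have h3 : ‖(1 - p + p * z : ℂ)‖ ^ 2 ≤ Real.exp (-(p * (1 - p) * c)) ^ 2 := by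
    rw [h2, ← Real.exp_nat_mul]
    have h4 := Real.add_one_le_exp (((2 : ℕ) : ℝ) * -(p * (1 - p) * c))
    have h5 : 0 ≤ p * (1 - p) := mul_nonneg hp0 (by linarith)
    have h6 : p * (1 - p) * c ≤ p * (1 - p) * (1 - z.re) :=
      mul_le_mul_of_nonneg_left (by linarith) h5
    push_cast at h4 ⊢
    linarith
  exact le_of_sq_le_sq h3 (Real.exp_pos _).le

theorem exists_re_stdAddChar_le (k : ℕ) [NeZero k] :
    ∃ c : ℝ, 0 < c ∧ ∀ j : ZMod k, j ≠ 0 → (ZMod.stdAddChar j : ℂ).re ≤ 1 - c := by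
  have h1 : ∀ j : ZMod k, j ≠ 0 → 0 < 1 - (ZMod.stdAddChar j : ℂ).re := by
    intro j hj
    have hn : ‖(ZMod.stdAddChar j : ℂ)‖ = 1 := AddChar.norm_apply _ _
    have hle := Complex.re_le_norm (ZMod.stdAddChar j : ℂ)
    rcases (hn ▸ hle).lt_or_eq with h | h
    · linarith
    · exfalso
      apply hj
      apply ZMod.injective_stdAddChar
      rw [AddChar.map_zero_eq_one]
      have h2 : ((ZMod.stdAddChar j : ℂ)).re = ‖(ZMod.stdAddChar j : ℂ)‖ := by rw [h, hn]
      have h3 := Complex.re_eq_norm.1 h2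
      rw [Complex.nonneg_iff] at h3
      exact Complex.ext (by simpa using h) (by simpa using h3.2.symm)
  by_cases hne : (Finset.univ.filter fun j : ZMod k => j ≠ 0).Nonempty
  · obtain ⟨j, hj, hmin⟩ := Finset.exists_min_image _
      (fun j : ZMod k => 1 - (ZMod.stdAddChar j : ℂ).re) hne
    refine ⟨_, h1 j (by simpa using hj), fun i hi => ?_⟩
    have := hmin i (by simpa using hi)
    linarith
  · refine ⟨1, one_pos, fun j hj => absurd ⟨j, by simpa using hj⟩ hne⟩

/-- A sum of independent bits is roughly equidistributed modulo `k` as soon as its variance is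
large, also after conditioning on one further bit. -/
theorem exists_le_bernoulliProb_residue (k : ℕ) [NeZero k] :
    ∃ K : ℝ, ∀ {ι : Type*} [Fintype ι] {p : ℝ}, 0 ≤ p → p ≤ 1 → ∀ (i : ι) (T : Finset ι),
      i ∉ T → K ≤ T.card * (p * (1 - p)) → ∀ x : ZMod k,
      p / (2 * k) ≤ bernoulliProb p
        (fun η : ι → Bool => η i = true ∧ x + ∑ t ∈ T, (if η t then 1 else 0) = 0) := by
  obtain ⟨c, hc0, hc⟩ := exists_re_stdAddChar_le k
  have hk : (0 : ℝ) < k := by exact_mod_cast Nat.pos_of_ne_zero (NeZero.ne k)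
  -- This constant makes each nontrivial Fourier coefficient at most `p / (2k)`, so the `k - 1` of
  -- them together cost at most half of the main term `p`.
  refine ⟨Real.log (2 * k) / c, ?_⟩
  intro ι _ p hp0 hp1 i T hiT hK x
  obtain ⟨Q, hQ⟩ : ∃ Q : (ι → Bool) → Prop,
      Q = fun η : ι → Bool => η i = true ∧ x + ∑ t ∈ T, (if η t then 1 else 0) = 0 := ⟨_, rfl⟩
  rw [← hQ]
  set P := bernoulliProb p Q with hP
  set e : ZMod k → ℂ := fun j => ZMod.stdAddChar j with he
  have hnorm : ∀ j, ‖e j‖ = 1 := fun j => AddChar.norm_apply _ _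
  -- Orthogonality of characters: the indicator that the sum vanishes, times `k`, is a sum over `j`,
  -- and each summand factors over the bits. Bit `i` contributes its own indicator, hence the factor
  -- `p` below.
  have h1 : ∀ η : ι → Bool, ((if Q η then 1 else 0 : ℝ) : ℂ) * k
      = ∑ j : ZMod k, e (j * x) * ∏ t, (if t = i then (if η t then 1 else 0) else
          if t ∈ T then (if η t then e j else 1) else 1) := by
    intro η
    have h2 : ∀ j : ZMod k, ∏ t, (if t = i then (if η t then 1 else 0) else
          if t ∈ T then (if η t then e j else 1) else 1 : ℂ)
        = (if η i then 1 else 0) * e (j * ∑ t ∈ T, (if η t then 1 else 0)) := by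
      intro j
      have h3 : ∀ t, (if t = i then (if η t then 1 else 0) else
          if t ∈ T then (if η t then e j else 1) else 1 : ℂ)
          = (if t = i then (if η t then 1 else 0) else 1) *
            (if t ∈ T then (if η t then e j else 1) else 1) := by
        intro t
        by_cases ht : t = i
        · subst ht; simp [hiT]
        · simp [ht]
      simp only [h3]
      rw [Finset.prod_mul_distrib, Finset.prod_ite_eq', Finset.prod_ite_mem]
      simp only [Finset.mem_univ, if_true, Finset.univ_inter]
      congr 1
      rw [Finset.mul_sum]
      simp only [he]
      have h8 : ∀ s : Finset ι, (ZMod.stdAddChar (∑ t ∈ s, j * (if η t then 1 else 0)) : ℂ)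
          = ∏ t ∈ s, if η t then (ZMod.stdAddChar j : ℂ) else 1 := by
        intro s
        induction s using Finset.induction_on with
        | empty => simp
        | insert t s ht ih =>
          rw [Finset.sum_insert ht, AddChar.map_add_eq_mul, ih, Finset.prod_insert ht]
          split_ifs <;> simp
      exact (h8 T).symm
    simp only [h2]
    have h4 := AddChar.sum_mulShift (x + ∑ t ∈ T, (if η t then 1 else 0) : ZMod k)
      (ZMod.isPrimitive_stdAddChar k)
    have h5 : ∀ j : ZMod k, e (j * x) * ((if η i then 1 else 0) *
        e (j * ∑ t ∈ T, (if η t then 1 else 0)))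
        = (if η i then 1 else 0) * e (j * (x + ∑ t ∈ T, (if η t then 1 else 0))) := by
      intro j
      simp only [he]
      rw [mul_add, AddChar.map_add_eq_mul]
      ring
    simp only [h5]
    rw [← Finset.mul_sum]
    simp only [he]
    rw [h4, ZMod.card]
    simp only [hQ]
    generalize x + ∑ t ∈ T, (if η t then 1 else 0) = y
    by_cases h6 : η i = true <;> by_cases h7 : y = 0 <;> simp [h6, h7]
  have h2 : (P : ℂ) * k = ∑ j : ZMod k, e (j * x) * (p * (1 - p + p * e j) ^ T.card) := by
    rw [hP, bernoulliProb, ofReal_bernoulliMean, mul_comm, ← bernoulliMean_const_mul]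
    simp only [mul_comm (k : ℂ), h1]
    rw [bernoulliMean_sum]
    refine Finset.sum_congr rfl fun j _ => ?_
    rw [bernoulliMean_const_mul]
    congr 1
    have h3 := bernoulliMean_prod (p : ℂ) (fun (t : ι) (b : Bool) =>
      (if t = i then (if b then 1 else 0) else if t ∈ T then (if b then e j else 1) else 1 : ℂ))
    rw [h3]
    have h4 : ∀ t, (p * (if t = i then (if true = true then 1 else 0) else
          if t ∈ T then (if true = true then e j else 1) else 1)
        + (1 - p) * (if t = i then (if false = true then 1 else 0) else
          if t ∈ T then (if false = true then e j else 1) else 1) : ℂ)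
        = (if t = i then (p : ℂ) else 1) * (if t ∈ T then 1 - p + p * e j else 1) := by
      intro t
      by_cases ht : t = i
      · subst ht; simp [hiT]
      · by_cases ht' : t ∈ T
        · simp [ht, ht']; ring
        · simp [ht, ht']
    rw [Finset.prod_congr rfl fun t _ => h4 t, Finset.prod_mul_distrib, Finset.prod_ite_eq',
      Finset.prod_ite_mem]
    simp
  have h3 : (P : ℂ) * k - p
      = ∑ j ∈ Finset.univ.erase (0 : ZMod k), e (j * x) * (p * (1 - p + p * e j) ^ T.card) := by
    rw [h2, ← Finset.add_sum_erase _ _ (Finset.mem_univ (0 : ZMod k))]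
    simp [he]
  have h4 : ∀ j ∈ Finset.univ.erase (0 : ZMod k),
      ‖e (j * x) * (p * (1 - p + p * e j) ^ T.card)‖ ≤ p * (1 / (2 * k)) := by
    intro j hj
    rw [norm_mul, norm_mul, norm_pow, hnorm, one_mul, Complex.norm_real, Real.norm_eq_abs,
      abs_of_nonneg hp0]
    refine mul_le_mul_of_nonneg_left ?_ hp0
    refine (pow_le_pow_left₀ (norm_nonneg _)
      (norm_one_sub_add_mul_le hp0 hp1 (hnorm j) (hc j (Finset.ne_of_mem_erase hj))) _).trans ?_
    rw [← Real.exp_nat_mul]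
    have h5 : (1 / (2 * k) : ℝ) = Real.exp (-Real.log (2 * k)) := by
      rw [Real.exp_neg, Real.exp_log (by positivity), one_div]
    rw [h5, Real.exp_le_exp]
    have := (div_le_iff₀ hc0).1 hK
    linarith
  have h5 : |P * k - p| ≤ (k - 1) * (p * (1 / (2 * k))) := by
    have h6 := norm_sum_le_of_le _ h4
    rw [← h3, Finset.sum_const, Finset.card_erase_of_mem (Finset.mem_univ _), Finset.card_univ,
      ZMod.card, nsmul_eq_mul, Nat.cast_sub (Nat.one_le_iff_ne_zero.2 (NeZero.ne k)),
      Nat.cast_one] at h6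
    have h7 : ((P : ℂ) * k - p) = ((P * k - p : ℝ) : ℂ) := by push_cast; ring
    rwa [h7, Complex.norm_real, Real.norm_eq_abs] at h6
  have h6 := (abs_le.1 h5).1
  have h7 : (k - 1) * (p * (1 / (2 * k))) ≤ p / 2 := by
    have : (k - 1) * (p * (1 / (2 * k))) = p / 2 - p / (2 * k) := by field_simp
    rw [this]
    have : 0 ≤ p / (2 * k) := by positivity
    linarith
  rw [div_le_iff₀ (by positivity)]
  linarith

end Residue

/-! ### Tail bounds for edge counts and degree classes. -/

section Estimates

variable {V : Type*} [Fintype V] {p : ℝ}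

theorem exp_neg_one_le_half : Real.exp (-1) ≤ 1 / 2 := by
  rw [Real.exp_neg, one_div]
  exact inv_anti₀ (by norm_num) (by linarith [Real.add_one_le_exp (1 : ℝ)])

theorem bernoulliProb_edges_between_le (hp0 : 0 ≤ p) (hp1 : p ≤ 1) {U W : Finset V}
    (hUW : Disjoint U W) (t : ℝ) :
    bernoulliProb p (fun ω : Sym2 V → Bool =>
      (∑ u ∈ U, ((W.filter fun w => (bitGraph ω).Adj u w).card : ℝ)) ≤ t)
      ≤ Real.exp (t - U.card * W.card * p / 2) := by
  set s : Finset (Sym2 V) := (U ×ˢ W).image fun x => s(x.1, x.2) with hs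
  have hinj : Set.InjOn (fun x : V × V => s(x.1, x.2)) (U ×ˢ W : Finset (V × V)) := by
    rintro ⟨a, b⟩ hab ⟨c, d⟩ hcd h
    simp only [Finset.coe_product, Set.mem_prod, Finset.mem_coe] at hab hcd
    simp only [Sym2.eq_iff] at h
    rcases h with ⟨rfl, rfl⟩ | ⟨rfl, rfl⟩
    · rfl
    · exact absurd hcd.2 (Finset.disjoint_left.1 hUW hab.1)
  have hcard : s.card = U.card * W.card := by
    rw [hs, Finset.card_image_of_injOn hinj, Finset.card_product]
  have hsum : ∀ ω : Sym2 V → Bool, (∑ u ∈ U, ((W.filter fun w => (bitGraph ω).Adj u w).card : ℝ))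
      = -∑ e ∈ s, if ω e then (-1 : ℝ) else 0 := by
    intro ω
    rw [hs, Finset.sum_image hinj, Finset.sum_product, ← Finset.sum_neg_distrib]
    refine Finset.sum_congr rfl fun u hu => ?_
    rw [Finset.card_filter, ← Finset.sum_neg_distrib]
    push_cast
    refine Finset.sum_congr rfl fun w hw => ?_
    have hne : u ≠ w := fun h => Finset.disjoint_left.1 hUW hu (h ▸ hw)
    simp only [bitGraph_adj, hne, ne_eq, not_false_eq_true, and_true]
    split_ifs <;> simp
  have h1 := bernoulliProb_le_exp_mul hp0 hp1
    (fun ω : Sym2 V → Bool => ∑ e ∈ s, if ω e then (-1 : ℝ) else 0) (-t)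
  have h2 := bernoulliMean_exp_sum_le hp0 hp1 s (-1)
  simp only [hsum, neg_le (b := t)]
  refine h1.trans ((mul_le_mul_of_nonneg_left h2 (Real.exp_pos _).le).trans ?_)
  rw [← Real.exp_add, Real.exp_le_exp, hcard]
  push_cast
  have h3 : (0 : ℝ) ≤ U.card * W.card * p := by positivity
  nlinarith [mul_le_mul_of_nonneg_left exp_neg_one_le_half h3]

/-- The sum counts each edge at most twice, so it is dominated by bits of weight 2; the constant 7
bounds `exp 2 - 1`. -/
theorem bernoulliProb_edges_inside_le (hp0 : 0 ≤ p) (hp1 : p ≤ 1) (U : Finset V) (t : ℝ) :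
    bernoulliProb p (fun ω : Sym2 V → Bool =>
      t ≤ (∑ u ∈ U, ((U.filter fun w => (bitGraph ω).Adj u w).card : ℝ)))
      ≤ Real.exp (7 * U.card ^ 2 * p - t) := by
  have hsum : ∀ ω : Sym2 V → Bool, (∑ u ∈ U, ((U.filter fun w => (bitGraph ω).Adj u w).card : ℝ))
      ≤ ∑ e ∈ U.sym2, if ω e then (2 : ℝ) else 0 := by
    intro ω
    have h1 : (∑ u ∈ U, ((U.filter fun w => (bitGraph ω).Adj u w).card : ℝ))
        = ∑ x ∈ U.offDiag, if ω s(x.1, x.2) then (1 : ℝ) else 0 := by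
      have h0 : U.offDiag = (U ×ˢ U).filter fun x => x.1 ≠ x.2 := by
        ext x
        simp [Finset.mem_offDiag, and_assoc]
      rw [h0, Finset.sum_filter, Finset.sum_product]
      refine Finset.sum_congr rfl fun u hu => ?_
      rw [Finset.card_filter]
      push_cast
      refine Finset.sum_congr rfl fun w hw => ?_
      by_cases h : u = w <;> simp [bitGraph_adj, h]
    have hmaps : ∀ x ∈ U.offDiag, s(x.1, x.2) ∈ U.sym2 := by
      intro x hx
      rw [Finset.mem_offDiag] at hx
      exact Finset.mk_mem_sym2_iff.2 ⟨hx.1, hx.2.1⟩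
    rw [h1, ← Finset.sum_fiberwise_of_maps_to hmaps]
    refine Finset.sum_le_sum fun e _ => ?_
    induction e using Sym2.inductionOn with
    | _ a b =>
      have h2 : ∀ x ∈ U.offDiag.filter (fun x => s(x.1, x.2) = s(a, b)),
          (if ω s(x.1, x.2) then (1 : ℝ) else 0) = if ω s(a, b) then 1 else 0 := by
        intro x hx
        rw [(Finset.mem_filter.1 hx).2]
      rw [Finset.sum_congr rfl h2, Finset.sum_const, nsmul_eq_mul]
      have h3 : (U.offDiag.filter (fun x => s(x.1, x.2) = s(a, b))).card ≤ 2 := by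
        refine (Finset.card_le_card (t := {(a, b), (b, a)}) ?_).trans Finset.card_le_two
        rintro ⟨c, d⟩ hx
        have := (Finset.mem_filter.1 hx).2
        simpa [Sym2.eq_iff] using this
      have h4 : ((U.offDiag.filter (fun x => s(x.1, x.2) = s(a, b))).card : ℝ) ≤ 2 := by
        exact_mod_cast h3
      split_ifs <;> linarith
  have h1 := bernoulliProb_le_exp_mul hp0 hp1
    (fun ω : Sym2 V → Bool => ∑ e ∈ U.sym2, if ω e then (2 : ℝ) else 0) t
  have h2 := bernoulliMean_exp_sum_le hp0 hp1 U.sym2 2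
  refine (bernoulliProb_mono hp0 hp1 fun ω h => h.trans (hsum ω)).trans ?_
  refine h1.trans ((mul_le_mul_of_nonneg_left h2 (Real.exp_pos _).le).trans ?_)
  rw [← Real.exp_add, Real.exp_le_exp]
  have h3 : (U.sym2.card : ℝ) ≤ U.card ^ 2 := by
    rw [Finset.card_sym2]
    norm_cast
    rw [Nat.choose_two_right, Nat.add_sub_cancel]
    apply Nat.div_le_of_le_mul
    nlinarith [Nat.zero_le U.card, Nat.le_mul_self U.card]
  have h4 : Real.exp 2 - 1 ≤ 7 := by
    have : Real.exp 2 = Real.exp 1 ^ 2 := by rw [← Real.exp_nat_mul]; norm_num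
    rw [this]
    nlinarith [Real.exp_one_lt_d9, Real.exp_pos 1]
  have h5 : p * (Real.exp 2 - 1) ≤ p * 7 := mul_le_mul_of_nonneg_left h4 hp0
  have h6 : 0 ≤ p * (Real.exp 2 - 1) :=
    mul_nonneg hp0 (by linarith [Real.add_one_le_exp (2 : ℝ)])
  have h7 := mul_le_mul h3 h5 h6 (by positivity)
  linarith

/-- The degrees of different vertices are dependent, but suitable blocks of bits are not. With
disjoint `q`-sets `X` and `Y` avoiding `v` and `S`, the pairs from `y ∈ X` to `Y ∪ {v}` form
disjoint blocks. Given all other bits, the block of `y` alone makes `y` a neighbour of `v` with the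
required residue with probability at least `p / (2k)`. -/
theorem exists_bernoulliProb_spread_le (k : ℕ) [NeZero k] :
    ∃ K : ℝ, ∀ {V : Type*} [Fintype V] {p : ℝ}, 0 ≤ p → p ≤ 1 → ∀ q : ℕ,
      2 * q + 2 ≤ Fintype.card V → K ≤ q * (p * (1 - p)) →
      ∀ (S : Finset V), S.card ≤ 1 → ∀ (v : V) (r : ZMod k) (t : ℝ),
      bernoulliProb p (fun ω : Sym2 V → Bool =>
        ((Finset.univ.filter fun y => y ∉ S ∧ (bitGraph ω).Adj v y ∧
          ((Finset.univ.filter fun u => u ∉ S ∧ (bitGraph ω).Adj y u).card : ZMod k) = r).card : ℝ)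
          ≤ t) ≤ Real.exp (t - q * (p / (4 * k))) := by
  obtain ⟨K, hK⟩ := exists_le_bernoulliProb_residue k
  refine ⟨K, ?_⟩
  intro V _ p hp0 hp1 q hq hKq S hS v r t
  have hk : (0 : ℝ) < k := by exact_mod_cast Nat.pos_of_ne_zero (NeZero.ne k)
  obtain ⟨X, hX, hXq⟩ : ∃ X ⊆ (insert v S)ᶜ, X.card = q := by
    apply Finset.exists_subset_card_eq
    rw [Finset.card_compl]
    have := Finset.card_insert_le v S
    omega
  obtain ⟨Y, hY, hYq⟩ : ∃ Y ⊆ (insert v S ∪ X)ᶜ, Y.card = q := by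
    apply Finset.exists_subset_card_eq
    rw [Finset.card_compl]
    have := Finset.card_insert_le v S
    have := Finset.card_union_le (insert v S) X
    omega
  have hXv : ∀ y ∈ X, y ≠ v ∧ y ∉ S := fun y hy => by
    have := hX hy; simpa [not_or] using this
  have hYv : ∀ u ∈ Y, u ≠ v ∧ u ∉ S ∧ u ∉ X := fun y hy => by
    have := hY hy; simpa [not_or] using this
  let Q : V → (Sym2 V → Bool) → Prop := fun y ω =>
    ω s(y, v) = true ∧
      ∑ u ∈ Finset.univ.filter (fun u => u ∉ S ∧ u ≠ y), (if ω s(y, u) then (1 : ZMod k) else 0) = r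
  let f : V → (Sym2 V → Bool) → ℝ := fun y ω => if Q y ω then Real.exp (-1) else 1
  let D : V → Set (Sym2 V) := fun y => {e | ∃ u ∈ insert v Y, e = s(y, u)}
  have hf0 : ∀ y ω, 0 ≤ f y ω := fun y ω => by
    simp only [f]; split_ifs
    · exact (Real.exp_pos _).le
    · exact zero_le_one
  have hmean := bernoulliMean_prod_le hp0 hp1 X D f (c := Real.exp (-(p / (4 * k)))) hf0 ?_ ?_
  · have h1 := bernoulliProb_le_exp_mul hp0 hp1
      (fun ω : Sym2 V → Bool => ∑ y ∈ X, if Q y ω then (-1 : ℝ) else 0) (-t)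
    have h2 : ∀ ω : Sym2 V → Bool, Real.exp (∑ y ∈ X, if Q y ω then (-1 : ℝ) else 0)
        = ∏ y ∈ X, f y ω := by
      intro ω
      rw [Real.exp_sum]
      refine Finset.prod_congr rfl fun y _ => ?_
      simp only [f]
      split_ifs <;> simp
    simp only [h2] at h1
    refine (bernoulliProb_mono hp0 hp1 fun ω h => ?_).trans
      (h1.trans ((mul_le_mul_of_nonneg_left hmean (Real.exp_pos _).le).trans_eq ?_))
    · have h3 : (∑ y ∈ X, if Q y ω then (-1 : ℝ) else 0)
          = -((X.filter fun y => Q y ω).card : ℝ) := by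
        rw [Finset.card_filter]
        push_cast
        rw [← Finset.sum_neg_distrib]
        refine Finset.sum_congr rfl fun y _ => ?_
        split_ifs <;> simp
      rw [h3]
      apply neg_le_neg
      refine le_trans ?_ h
      norm_cast
      apply Finset.card_le_card
      intro y hy
      obtain ⟨hyX, hyQ⟩ := Finset.mem_filter.1 hy
      refine Finset.mem_filter.2 ⟨Finset.mem_univ _, (hXv y hyX).2, ?_, ?_⟩
      · rw [bitGraph_adj, Sym2.eq_swap]
        exact ⟨hyQ.1, (hXv y hyX).1.symm⟩
      · rw [← hyQ.2, Finset.sum_ite, Finset.sum_const_zero, add_zero, Finset.sum_const,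
          nsmul_eq_mul, mul_one, Finset.filter_filter]
        congr 2
        ext u
        simp only [Finset.mem_filter, Finset.mem_univ, true_and, bitGraph_adj]
        constructor
        · rintro ⟨h1, h2, h3⟩
          exact ⟨⟨h1, h3.symm⟩, h2⟩
        · rintro ⟨⟨h1, h3⟩, h2⟩
          exact ⟨h1, h2, h3.symm⟩
    · rw [hXq, ← Real.exp_nat_mul, ← Real.exp_add]
      congr 1
      ring
  · intro a ha b hb hab η ω
    have h1 : ∀ u, resample (D b) η ω s(a, u) = ω s(a, u) := by
      intro u
      apply resample_of_notMem
      rintro ⟨w, hw, h⟩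
      rw [Sym2.eq_iff] at h
      rcases h with ⟨h, -⟩ | ⟨h, -⟩
      · exact hab h
      · subst h
        rcases Finset.mem_insert.1 hw with h | h
        · exact (hXv a ha).1 h
        · exact (hYv a h).2.2 ha
    simp only [f, Q, h1]
  · intro y hy ω
    obtain ⟨hyv, hyS⟩ := hXv y hy
    set T : Finset (Sym2 V) := Y.image fun u => s(y, u) with hT
    have hinj : Function.Injective fun u : V => s(y, u) := by
      intro u w h
      simp only [Sym2.eq_iff] at h
      rcases h with ⟨-, h⟩ | ⟨h, h'⟩
      · exact h
      · exact h'.trans h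
    have hTq : T.card = q := by rw [hT, Finset.card_image_of_injective _ hinj, hYq]
    have hvT : s(y, v) ∉ T := by
      rw [hT, Finset.mem_image]
      rintro ⟨u, hu, h⟩
      exact (hYv u hu).1 (hinj h)
    set A : Finset V := Finset.univ.filter (fun u => u ∉ S ∧ u ≠ y) with hA
    have hYA : Y ⊆ A := fun u hu => by
      rw [hA, Finset.mem_filter]
      exact ⟨Finset.mem_univ _, (hYv u hu).2.1, fun h => (hYv u hu).2.2 (h ▸ hy)⟩
    -- The frozen part of the degree of `y`. The pair `yv` is counted as present, since only
    -- outcomes with that edge matter.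
    set x : ZMod k := ∑ u ∈ A \ Y, (if u = v ∨ ω s(y, u) = true then (1 : ZMod k) else 0) - r
      with hx
    have hres := hK hp0 hp1 s(y, v) T hvT (by rw [hTq]; exact hKq) x
    have himp : ∀ η : Sym2 V → Bool,
        (η s(y, v) = true ∧ x + ∑ t ∈ T, (if η t then 1 else 0) = 0) →
          Q y (resample (D y) η ω) := by
      rintro η ⟨h1, h2⟩
      have hv : resample (D y) η ω s(y, v) = true := by
        rw [resample_of_mem (show s(y, v) ∈ D y from ⟨v, Finset.mem_insert_self _ _, rfl⟩), h1]
      refine ⟨hv, ?_⟩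
      rw [← hA, ← Finset.sum_sdiff hYA]
      have h3 : ∑ u ∈ Y, (if resample (D y) η ω s(y, u) then (1 : ZMod k) else 0)
          = ∑ t ∈ T, (if η t then 1 else 0) := by
        rw [hT, Finset.sum_image hinj.injOn]
        refine Finset.sum_congr rfl fun u hu => ?_
        rw [resample_of_mem (show s(y, u) ∈ D y from ⟨u, Finset.mem_insert_of_mem hu, rfl⟩)]
      have h4 : ∑ u ∈ A \ Y, (if resample (D y) η ω s(y, u) then (1 : ZMod k) else 0)
          = ∑ u ∈ A \ Y, (if u = v ∨ ω s(y, u) = true then (1 : ZMod k) else 0) := by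
        refine Finset.sum_congr rfl fun u hu => ?_
        by_cases huv : u = v
        · subst huv
          simp [hv]
        · have h5 : resample (D y) η ω s(y, u) = ω s(y, u) := by
            apply resample_of_notMem
            rintro ⟨w, hw, h⟩
            have := hinj h
            subst this
            rcases Finset.mem_insert.1 hw with h | h
            · exact huv h
            · exact (Finset.mem_sdiff.1 hu).2 h
          simp [h5, huv]
      rw [h3, h4]
      rw [hx] at h2
      linear_combination h2
    have h1 : p / (2 * k) ≤ bernoulliProb p (fun η => Q y (resample (D y) η ω)) :=
      hres.trans (bernoulliProb_mono hp0 hp1 himp)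
    -- With `1 - exp (-1) ≥ 1 / 2` and success probability at least `p / (2k)`, this mean is at most
    -- `1 - p / (4k) ≤ exp (-(p / (4k)))`.
    have h2 : bernoulliMean p (fun η => f y (resample (D y) η ω))
        = 1 - (1 - Real.exp (-1)) * bernoulliProb p (fun η => Q y (resample (D y) η ω)) := by
      rw [bernoulliProb, ← bernoulliMean_const_mul,
        ← bernoulliMean_const (ι := Sym2 V) p (1 : ℝ), ← bernoulliMean_sub, bernoulliMean_const]
      congr 1
      ext η
      simp only [f]
      split_ifs <;> ring
    rw [h2]
    have h3 := Real.add_one_le_exp (-(p / (4 * k)))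
    have h4 : p / (4 * k) = 1 / 2 * (p / (2 * k)) := by field_simp; norm_num
    have h5 : 0 ≤ p / (2 * k) := by positivity
    have h6 := exp_neg_one_le_half
    nlinarith

end Estimates

/-! ### The random graph is pseudo-random with high probability. -/

section PseudoRandom

/-- The pseudo-random properties of `G` that determine its mod `k` chromatic index. -/
structure PseudoRandom {V : Type*} [Fintype V] (G : SimpleGraph V) (k : ℕ) (d m Δ : ℝ) :
    Prop where
  /-- After deleting at most one vertex, every vertex has many neighbours in each degree class. -/
  spread : ∀ S : Finset V, S.card ≤ 1 → ∀ (v : V) (r : ZMod k),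
    d < (Finset.univ.filter fun y => y ∉ S ∧ G.Adj v y ∧
      ((Finset.univ.filter fun u => u ∉ S ∧ G.Adj y u).card : ZMod k) = r).card
  /-- Small sets span few edges. -/
  sparse : ∀ U : Finset V, U.Nonempty → (U.card : ℝ) ≤ 8 * m →
    (∑ u ∈ U, ((U.filter fun w => G.Adj u w).card : ℝ)) < U.card * (d / 4)
  /-- There are many edges between large sets. -/
  dense : ∀ U W : Finset V, Disjoint U W → m ≤ U.card → m ≤ W.card →
    Δ * Fintype.card V < ∑ u ∈ U, ((W.filter fun w => G.Adj u w).card : ℝ)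

/-- By the binomial theorem the sum is `(1 + x) ^ n - 1 ≤ exp (n x) - 1`. It serves the union bound
over vertex sets of all sizes. -/
theorem sum_pow_card_nonempty_le {V : Type*} [Fintype V] (x : ℝ) (hx : 0 ≤ x)
    (h : Fintype.card V * x ≤ 1) :
    ∑ U ∈ (Finset.univ : Finset V).powerset.filter Finset.Nonempty, x ^ U.card
      ≤ 2 * (Fintype.card V * x) := by
  have h1 : ∑ U ∈ (Finset.univ : Finset V).powerset, x ^ U.card = (x + 1) ^ Fintype.card V := by
    have := Finset.prod_add_one (s := (Finset.univ : Finset V)) (f := fun _ => x)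
    simp only [Finset.prod_const, Finset.card_univ] at this
    exact this.symm
  have h2 : ∑ U ∈ (Finset.univ : Finset V).powerset.filter Finset.Nonempty, x ^ U.card + 1
      = (x + 1) ^ Fintype.card V := by
    rw [← h1, ← Finset.sum_filter_add_sum_filter_not (Finset.univ : Finset V).powerset
      Finset.Nonempty]
    congr 1
    have : (Finset.univ : Finset V).powerset.filter (fun U => ¬ U.Nonempty) = {∅} := by
      ext U
      simp [Finset.not_nonempty_iff_eq_empty]
    rw [this]
    simp
  have h3 : (x + 1) ^ Fintype.card V ≤ Real.exp (Fintype.card V * x) := by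
    rw [Real.exp_nat_mul]
    exact pow_le_pow_left₀ (by linarith) (Real.add_one_le_exp x) _
  have h4 : 0 ≤ Fintype.card V * x := by positivity
  have h5 := Real.abs_exp_sub_one_le (x := Fintype.card V * x) (by rw [abs_of_nonneg h4]; exact h)
  rw [abs_of_nonneg h4] at h5
  have h6 := (abs_le.1 h5).2
  linarith

/-- A union bound for each property: at most `2n · nk` triples, each failing with probability at
most `n⁻⁴`; sets of size `u`, each failing with probability at most `n ^ (-3u)`; and at most `4 ^ n`
pairs of sets, each failing with probability at most `exp (-3n)`. -/
theorem exists_bernoulliProb_not_pseudoRandom_le (k : ℕ) [NeZero k] :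
    ∃ K : ℝ, ∀ {V : Type*} [Fintype V] {p d m Δ : ℝ}, 0 ≤ p → p ≤ 1 →
      8 ≤ Fintype.card V → K ≤ Fintype.card V * (p * (1 - p)) →
      768 * k * Real.log (Fintype.card V) ≤ Fintype.card V * p →
      d = Fintype.card V * p / (32 * k) →
      m = Fintype.card V / (14336 * k) →
      (Δ + 3) * Fintype.card V ≤ m ^ 2 * p / 2 →
      bernoulliProb p (fun ω : Sym2 V → Bool => ¬ PseudoRandom (bitGraph ω) k d m Δ)
        ≤ (2 * k + 3) / Fintype.card V := by
  obtain ⟨K, hK⟩ := exists_bernoulliProb_spread_le k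
  refine ⟨4 * |K|, ?_⟩
  intro V _ p d m Δ hp0 hp1 hn8 hvar hlog hd hm hΔ
  set n := Fintype.card V with hn
  have hk : (1 : ℝ) ≤ k := by exact_mod_cast Nat.one_le_iff_ne_zero.2 (NeZero.ne k)
  have hn8' : (8 : ℝ) ≤ n := by exact_mod_cast hn8
  have hexp : ∀ j : ℕ, Real.exp (-(j * Real.log n)) = ((n : ℝ) ^ j)⁻¹ := by
    intro j
    rw [Real.exp_neg, Real.exp_nat_mul, Real.exp_log (by linarith)]
  have hm0 : 0 ≤ m := by rw [hm]; positivity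
  have hlog0 : 0 ≤ Real.log n := Real.log_nonneg (by linarith)
  set Q₁ : (Sym2 V → Bool) → Prop := fun ω =>
    ∃ x ∈ (Finset.univ.filter fun S : Finset V => S.card ≤ 1) ×ˢ
        (Finset.univ : Finset (V × ZMod k)),
      ((Finset.univ.filter fun y => y ∉ x.1 ∧ (bitGraph ω).Adj x.2.1 y ∧
          ((Finset.univ.filter fun u => u ∉ x.1 ∧ (bitGraph ω).Adj y u).card : ZMod k) = x.2.2).card
            : ℝ) ≤ d with hQ₁
  set Q₂ : (Sym2 V → Bool) → Prop := fun ω =>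
    ∃ U ∈ ((Finset.univ : Finset V).powerset.filter Finset.Nonempty).filter
        (fun U => (U.card : ℝ) ≤ 8 * m),
      U.card * (d / 4) ≤ ∑ u ∈ U, ((U.filter fun w => (bitGraph ω).Adj u w).card : ℝ) with hQ₂
  set Q₃ : (Sym2 V → Bool) → Prop := fun ω =>
    ∃ x ∈ (Finset.univ : Finset (Finset V × Finset V)).filter
        (fun x => Disjoint x.1 x.2 ∧ m ≤ x.1.card ∧ m ≤ x.2.card),
      (∑ u ∈ x.1, ((x.2.filter fun w => (bitGraph ω).Adj u w).card : ℝ)) ≤ Δ * n with hQ₃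
  have hsub : ∀ ω : Sym2 V → Bool, ¬ PseudoRandom (bitGraph ω) k d m Δ →
      Q₁ ω ∨ (Q₂ ω ∨ Q₃ ω) := by
    intro ω hω
    by_contra! hcon
    obtain ⟨h1, h2, h3⟩ := hcon
    refine hω ⟨fun S hS v r => ?_, fun U hU hUm => ?_, fun U W hUW hU hW => ?_⟩
    · by_contra! h
      exact h1 ⟨(S, v, r), by simpa using hS, h⟩
    · by_contra! h
      exact h2 ⟨U, by simpa using ⟨hU, hUm⟩, h⟩
    · by_contra! h
      exact h3 ⟨(U, W), by simpa using ⟨hUW, hU, hW⟩, h⟩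
  have hsum := (bernoulliProb_mono hp0 hp1 hsub).trans
    ((bernoulliProb_or_le hp0 hp1 Q₁ _).trans
      (add_le_add_right (bernoulliProb_or_le hp0 hp1 Q₂ Q₃) _))
  have b1 : bernoulliProb p Q₁ ≤ 2 * k / n := by
    refine (bernoulliProb_exists_le hp0 hp1 _ _).trans ?_
    have hq1 : (n : ℝ) / 4 ≤ ((n / 3 : ℕ) : ℝ) := by
      have : n ≤ 4 * (n / 3) := by omega
      have : (n : ℝ) ≤ 4 * ((n / 3 : ℕ) : ℝ) := by exact_mod_cast this
      linarith
    have hp2 : 0 ≤ p * (1 - p) := mul_nonneg hp0 (by linarith)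
    have hbound : ∀ x ∈ (Finset.univ.filter fun S : Finset V => S.card ≤ 1) ×ˢ
        (Finset.univ : Finset (V × ZMod k)), bernoulliProb p (fun ω : Sym2 V → Bool =>
        ((Finset.univ.filter fun y => y ∉ x.1 ∧ (bitGraph ω).Adj x.2.1 y ∧
          ((Finset.univ.filter fun u => u ∉ x.1 ∧ (bitGraph ω).Adj y u).card : ZMod k) = x.2.2).card
            : ℝ) ≤ d) ≤ ((n : ℝ) ^ 4)⁻¹ := by
      rintro ⟨S, v, r⟩ hx
      have hS : S.card ≤ 1 := by simpa using hx
      refine (hK hp0 hp1 (n / 3) (by omega) ?_ S hS v r d).trans ?_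
      · have := le_abs_self K
        nlinarith
      -- Since `n / 3` rounded down is at least `n / 4`, the expected count is at least `2d`,
      -- leaving `exp (-d)`; and `d ≥ 24 log n` because `768 = 24 · 32`.
      · rw [← hexp, Real.exp_le_exp, hd]
        have h1 : (n : ℝ) / 4 * (p / (4 * k)) ≤ ((n / 3 : ℕ) : ℝ) * (p / (4 * k)) :=
          mul_le_mul_of_nonneg_right hq1 (by positivity)
        have h2 : (n : ℝ) / 4 * (p / (4 * k)) = 2 * (n * p / (32 * k)) := by field_simp; ring
        have h3 : 24 * Real.log n ≤ n * p / (32 * k) := by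
          rw [le_div_iff₀ (by positivity)]
          linarith
        push_cast
        linarith
    refine (Finset.sum_le_sum hbound).trans ?_
    rw [Finset.sum_const, nsmul_eq_mul, Finset.card_product]
    have hc : ((Finset.univ.filter fun S : Finset V => S.card ≤ 1)).card ≤ n + 1 := by
      have : (Finset.univ.filter fun S : Finset V => S.card ≤ 1)
          ⊆ insert ∅ (Finset.univ.image fun v : V => ({v} : Finset V)) := by
        intro S hS
        have hS' : S.card ≤ 1 := by simpa using hS
        rcases S.eq_empty_or_nonempty with rfl | ⟨v, hv⟩
        · exact Finset.mem_insert_self _ _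
        · refine Finset.mem_insert_of_mem (Finset.mem_image.2 ⟨v, Finset.mem_univ _, ?_⟩)
          exact (Finset.eq_singleton_iff_unique_mem.2
            ⟨hv, fun w hw => Finset.card_le_one.1 hS' w hw v hv⟩).symm
      refine (Finset.card_le_card this).trans ((Finset.card_insert_le _ _).trans ?_)
      exact Nat.succ_le_succ Finset.card_image_le
    have hc' : (((Finset.univ.filter fun S : Finset V => S.card ≤ 1)).card : ℝ) ≤ 2 * n := by
      have : (((Finset.univ.filter fun S : Finset V => S.card ≤ 1)).card : ℝ) ≤ n + 1 := by
        exact_mod_cast hc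
      linarith
    have hc2 : ((Finset.univ : Finset (V × ZMod k)).card : ℝ) = n * k := by
      rw [Finset.card_univ, Fintype.card_prod, ZMod.card]
      push_cast
      rfl
    push_cast
    rw [hc2, ← div_eq_mul_inv, div_le_div_iff₀ (by positivity) (by linarith)]
    calc _ ≤ (2 * n) * (n * k) * (n : ℝ) := by gcongr
      _ = 2 * k * (n : ℝ) ^ 3 := by ring
      _ ≤ _ := by gcongr; · linarith
                  · norm_num
  have b2 : bernoulliProb p Q₂ ≤ 2 / n := by
    refine (bernoulliProb_exists_le hp0 hp1 _ _).trans ?_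
    have hbound : ∀ U ∈ ((Finset.univ : Finset V).powerset.filter Finset.Nonempty).filter
        (fun U => (U.card : ℝ) ≤ 8 * m), bernoulliProb p (fun ω : Sym2 V → Bool =>
          U.card * (d / 4) ≤ ∑ u ∈ U, ((U.filter fun w => (bitGraph ω).Adj u w).card : ℝ))
          ≤ (((n : ℝ) ^ 3)⁻¹) ^ U.card := by
      intro U hU
      have hUm : (U.card : ℝ) ≤ 8 * m := (Finset.mem_filter.1 hU).2
      refine (bernoulliProb_edges_inside_le hp0 hp1 U _).trans ?_
      rw [← hexp, ← Real.exp_nat_mul, Real.exp_le_exp]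
      -- The value of `m` is chosen for this: `7 · 8 · m · p = d / 8`, as `14336 = 56 · 256`. Half
      -- of the threshold `d / 4` survives in the exponent.
      have h1 : (7 * U.card ^ 2 * p : ℝ) ≤ U.card * (d / 8) := by
        calc (7 * U.card ^ 2 * p : ℝ) = U.card * (7 * p * U.card) := by ring
          _ ≤ U.card * (7 * p * (8 * m)) := by gcongr
          _ = U.card * (d / 8) := by rw [hd, hm]; field_simp; ring
      have h2 : 3 * Real.log n ≤ d / 8 := by
        rw [hd, div_div, le_div_iff₀ (by positivity)]
        linarith
      have h3 := mul_le_mul_of_nonneg_left h2 (Nat.cast_nonneg (α := ℝ) U.card)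
      push_cast
      linarith
    refine (Finset.sum_le_sum hbound).trans ?_
    refine (Finset.sum_le_sum_of_subset_of_nonneg (Finset.filter_subset _ _)
      fun _ _ _ => by positivity).trans ?_
    have h1 : (n : ℝ) * ((n : ℝ) ^ 3)⁻¹ ≤ 1 / n := by
      rw [← div_eq_mul_inv, div_le_div_iff₀ (by positivity) (by linarith)]
      calc (n : ℝ) * n = n ^ 2 := by ring
        _ ≤ (n : ℝ) ^ 3 := by gcongr; · linarith
                              · norm_num
        _ = _ := by ring
    have h2 : 1 / (n : ℝ) ≤ 1 := by
      rw [div_le_one (by linarith)]; linarith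
    refine (sum_pow_card_nonempty_le _ (by positivity) (h1.trans h2)).trans ?_
    calc _ ≤ 2 * (1 / (n : ℝ)) := by gcongr
      _ = _ := by ring
  have b3 : bernoulliProb p Q₃ ≤ 1 / n := by
    refine (bernoulliProb_exists_le hp0 hp1 _ _).trans ?_
    have hbound : ∀ x ∈ (Finset.univ : Finset (Finset V × Finset V)).filter
        (fun x => Disjoint x.1 x.2 ∧ m ≤ x.1.card ∧ m ≤ x.2.card),
        bernoulliProb p (fun ω : Sym2 V → Bool =>
          (∑ u ∈ x.1, ((x.2.filter fun w => (bitGraph ω).Adj u w).card : ℝ)) ≤ Δ * n)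
          ≤ Real.exp (-(3 * n)) := by
      intro x hx
      obtain ⟨-, hx1, hx2, hx3⟩ := Finset.mem_filter.1 hx
      refine (bernoulliProb_edges_between_le hp0 hp1 hx1 _).trans ?_
      rw [Real.exp_le_exp]
      have h1 : m ^ 2 * p / 2 ≤ x.1.card * x.2.card * p / 2 := by
        rw [sq]
        gcongr
      linarith
    refine (Finset.sum_le_sum hbound).trans ?_
    rw [Finset.sum_const, nsmul_eq_mul]
    have h1 : ((Finset.univ : Finset (Finset V × Finset V)).filter
        (fun x => Disjoint x.1 x.2 ∧ m ≤ x.1.card ∧ m ≤ x.2.card)).card ≤ 2 ^ n * 2 ^ n := by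
      refine (Finset.card_filter_le _ _).trans ?_
      rw [Finset.card_univ, Fintype.card_prod, Fintype.card_finset]
    have h2 : (2 : ℝ) ^ n ≤ Real.exp n := by
      rw [← mul_one (n : ℝ), Real.exp_nat_mul]
      exact pow_le_pow_left₀ (by norm_num) (by linarith [Real.add_one_le_exp (1 : ℝ)]) _
    calc _ ≤ ((2 : ℝ) ^ n * 2 ^ n) * Real.exp (-(3 * n)) := by
          gcongr
          exact_mod_cast h1
      _ ≤ (Real.exp n * Real.exp n) * Real.exp (-(3 * n)) := by gcongr
      _ = Real.exp (-n) := by rw [← Real.exp_add, ← Real.exp_add]; congr 1; ring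
      _ ≤ _ := by
        rw [Real.exp_neg, one_div]
        exact inv_anti₀ (by linarith) (by linarith [Real.add_one_le_exp (n : ℝ)])
  refine hsum.trans ((add_le_add b1 (add_le_add b2 b3)).trans_eq ?_)
  ring

/-- The bridge to the deterministic part: a property forced by pseudo-randomness, for large `n`,
holds with probability tending to 1. -/
theorem exists_tendsto_binomialRandom_of_pseudoRandom (k : ℕ) [NeZero k] (D Δ : ℝ) :
    ∃ C : ℝ, 0 < C ∧ ∀ p : ℕ → unitInterval,
      (∀ᶠ n : ℕ in Filter.atTop, C * Real.log n / n ≤ (p n : ℝ)) →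
      Filter.Tendsto (fun n : ℕ => (n : ℝ) * (1 - (p n : ℝ))) Filter.atTop Filter.atTop →
      ∀ A : ∀ n : ℕ, Set (SimpleGraph (Fin n)),
      (∀ᶠ n : ℕ in Filter.atTop, ∀ (G : SimpleGraph (Fin n)) (d m : ℝ), D ≤ d → 0 < m →
        PseudoRandom G k d m Δ → G ∈ A n) →
      Filter.Tendsto (fun n : ℕ => SimpleGraph.binomialRandom (Fin n) (p n) (A n))
        Filter.atTop (nhds 1) := by
  obtain ⟨K, hK⟩ := exists_bernoulliProb_not_pseudoRandom_le k
  have hk : (1 : ℝ) ≤ k := by exact_mod_cast Nat.one_le_iff_ne_zero.2 (NeZero.ne k)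
  refine ⟨768 * k, by positivity, ?_⟩
  intro p hp1 hp2 A hA
  have hlog : Filter.Tendsto (fun n : ℕ => Real.log n) Filter.atTop Filter.atTop :=
    Real.tendsto_log_atTop.comp tendsto_natCast_atTop_atTop
  have hev : ∀ᶠ n : ℕ in Filter.atTop,
      1 - (2 * k + 3) / (n : ℝ) ≤ bernoulliProb (p n : ℝ) fun ω : Sym2 (Fin n) → Bool =>
        bitGraph ω ∈ A n := by
    filter_upwards [hp1, hA, Filter.eventually_ge_atTop 8, hp2.eventually_ge_atTop (2 * K),
      hlog.eventually_ge_atTop (2 * K), hlog.eventually_ge_atTop D, hlog.eventually_ge_atTop 0,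
      hlog.eventually_ge_atTop ((Δ + 3) * (2 * (14336 * k) ^ 2))] with n h1 h2 h3 h4 h5 h6 h0 h7
    have hn : (8 : ℝ) ≤ n := by exact_mod_cast h3
    have hp0 : 0 ≤ (p n : ℝ) := (p n).2.1
    have hp1 : (p n : ℝ) ≤ 1 := (p n).2.2
    rw [div_le_iff₀ (by linarith)] at h1
    have hnp : Real.log n ≤ n * (p n : ℝ) := by nlinarith
    have hcard : ((Fintype.card (Fin n) : ℕ) : ℝ) = n := by rw [Fintype.card_fin]
    have hmain := hK (V := Fin n) (p := p n) (d := Fintype.card (Fin n) * p n / (32 * k))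
      (m := Fintype.card (Fin n) / (14336 * k)) (Δ := Δ) hp0 hp1
      (by rw [Fintype.card_fin]; exact h3) ?_ ?_ rfl rfl ?_
    · rw [bernoulliProb_not, hcard] at hmain
      have hle : bernoulliProb (p n : ℝ) (fun ω : Sym2 (Fin n) → Bool =>
          PseudoRandom (bitGraph ω) k (n * p n / (32 * k)) (n / (14336 * k)) Δ)
          ≤ bernoulliProb (p n : ℝ) fun ω : Sym2 (Fin n) → Bool => bitGraph ω ∈ A n := by
        refine bernoulliProb_mono hp0 hp1 fun ω hω => h2 _ _ _ ?_ (by positivity) hω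
        rw [le_div_iff₀ (by positivity)]
        nlinarith
      linarith
    · rw [hcard]
      -- The variance `np(1 - p)` is at least `np / 2` or `n(1 - p) / 2`, and both tend to infinity.
      rcases le_total (p n : ℝ) (1 / 2) with h | h
      · have : n * (p n : ℝ) * (1 / 2) ≤ n * (p n : ℝ) * (1 - p n) :=
          mul_le_mul_of_nonneg_left (by linarith) (by positivity)
        linarith
      · have : n * (1 - (p n : ℝ)) * (1 / 2) ≤ n * (1 - (p n : ℝ)) * p n :=
          mul_le_mul_of_nonneg_left h (mul_nonneg (by linarith) (by linarith))
        linarith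
    · rw [hcard]; linarith
    · rw [hcard]
      have h8 : (Δ + 3) ≤ n * (p n : ℝ) / (2 * (14336 * k) ^ 2) := by
        rw [le_div_iff₀ (by positivity)]; linarith
      calc (Δ + 3) * n ≤ n * (p n : ℝ) / (2 * (14336 * k) ^ 2) * n := by gcongr
        _ = _ := by field_simp
  have hlim : Filter.Tendsto (fun n : ℕ => 1 - (2 * k + 3) / (n : ℝ)) Filter.atTop (nhds 1) := by
    have := (tendsto_const_div_atTop_nhds_zero_nat (2 * (k : ℝ) + 3)).const_sub 1
    simpa using this
  have hlim' := (ENNReal.continuous_ofReal.tendsto 1).comp hlim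
  rw [ENNReal.ofReal_one] at hlim'
  refine tendsto_of_tendsto_of_tendsto_of_le_of_le' hlim' tendsto_const_nhds ?_
    (Filter.Eventually.of_forall fun n => MeasureTheory.prob_le_one)
  filter_upwards [hev] with n hn
  rw [binomialRandom_eq_bernoulliProb]
  exact ENNReal.ofReal_le_ofReal hn

end PseudoRandom

/-! ### Perfect matchings from expansion. -/

section Matching

/-- Suppose `S` violates Tutte's condition. Edges between large sets force a component of `G - S`
that misses fewer than `m` vertices. The other components lie in the small remainder `W`, so `S` is
no larger than `W`; but then `W` has a neighbour outside `W ∪ S`, which is impossible for a union of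
components. -/
theorem exists_isPerfectMatching_of_expansion {V : Type*} [Fintype V] (G : SimpleGraph V) {m : ℝ}
    (hm : 0 < m) (heven : Even (Fintype.card V)) (hcard : 6 * m ≤ Fintype.card V)
    (hsmall : ∀ W S : Finset V, W.Nonempty → S.card ≤ W.card → (W.card : ℝ) ≤ m →
      ∃ w ∈ W, ∃ y, y ∉ W ∧ y ∉ S ∧ G.Adj w y)
    (hlarge : ∀ U W : Finset V, Disjoint U W → m ≤ U.card → m ≤ W.card →
      ∃ u ∈ U, ∃ w ∈ W, G.Adj u w) :
    ∃ M : G.Subgraph, M.IsPerfectMatching := by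
  rw [SimpleGraph.tutte]
  intro S hS
  rw [SimpleGraph.IsTutteViolator] at hS
  set H := ((⊤ : G.Subgraph).deleteVerts S).coe with hH
  have hodd : S.ncard + 1 ≤ Fintype.card H.ConnectedComponent := by
    refine hS.trans_le ?_
    rw [← Nat.card_eq_fintype_card, ← Set.ncard_univ]
    exact Set.ncard_le_ncard (Set.subset_univ _)
  have hmem : ∀ v, v ∈ ((⊤ : G.Subgraph).deleteVerts S).verts ↔ v ∉ S := by simp
  let comp : H.ConnectedComponent → Finset V := fun c =>
    Finset.univ.filter fun v => ∃ h, H.connectedComponentMk ⟨v, h⟩ = c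
  have hcomp : ∀ c, ∀ u ∈ comp c, ∀ y, y ∉ S → G.Adj u y → y ∈ comp c := by
    intro c u hu y hy huy
    obtain ⟨hu', hc⟩ : ∃ h, H.connectedComponentMk ⟨u, h⟩ = c := by simpa [comp] using hu
    have hy' := (hmem y).2 hy
    have hadj : H.Adj ⟨y, hy'⟩ ⟨u, hu'⟩ := by
      rw [hH, SimpleGraph.Subgraph.coe_adj, SimpleGraph.Subgraph.deleteVerts_adj]
      have := (hmem u).1 hu'
      simp [hy, this, huy.symm]
    simp only [comp, Finset.mem_filter, Finset.mem_univ, true_and]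
    exact ⟨hy', (SimpleGraph.ConnectedComponent.connectedComponentMk_eq_of_adj hadj).trans hc⟩
  set T : Finset V := S.toFinset with hT
  set R : Finset V := Tᶜ with hR
  have hmemR : ∀ v, v ∈ R ↔ v ∉ S := by intro v; simp [hR, hT]
  have hTcard : T.card = S.ncard := by rw [hT, Set.ncard_eq_toFinset_card']
  have hTR : (T.card : ℝ) + R.card = Fintype.card V := by
    have := Finset.card_add_card_compl T
    exact_mod_cast this
  have hverts : Fintype.card ↥((⊤ : G.Subgraph).deleteVerts S).verts = R.card := by
    rw [Fintype.card_subtype]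
    congr 1
    ext v
    simp [hmemR]
  have hsurj : Function.Surjective H.connectedComponentMk := fun c => by
    induction c using SimpleGraph.ConnectedComponent.ind with
    | _ v => exact ⟨v, rfl⟩
  have hRm : 3 * m ≤ R.card := by
    by_contra! h
    have h1 : T.card + 1 ≤ R.card := by
      rw [hTcard, ← hverts]
      exact hodd.trans (Fintype.card_le_of_surjective _ hsurj)
    have h2 : (T.card : ℝ) + 1 ≤ R.card := by exact_mod_cast h1
    linarith
  let closed : Finset V → Prop := fun U => ∀ u ∈ U, ∀ y, y ∉ S → G.Adj u y → y ∈ U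
  have hcl_diff : ∀ U W, U ⊆ R → closed U → closed W → closed (U \ W) := by
    intro U W hUR hU hW u hu y hy huy
    rw [Finset.mem_sdiff] at hu ⊢
    exact ⟨hU u hu.1 y hy huy, fun h => hu.2 (hW y h u ((hmemR u).1 (hUR hu.1)) huy.symm)⟩
  have hclR : closed R := fun u _ y hy _ => (hmemR y).2 hy
  -- A smallest union of components with at least `m` vertices. If it met two components, it would
  -- split into two parts smaller than `m`; as fewer than `m` vertices lie outside it, `R` would
  -- have fewer than `3m`.
  obtain ⟨U, hU, hUmin⟩ := Finset.exists_min_image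
    (R.powerset.filter fun U => closed U ∧ m ≤ U.card) Finset.card
    ⟨R, by
      simp only [Finset.mem_filter, Finset.mem_powerset, Finset.Subset.refl, true_and]
      exact ⟨hclR, by linarith⟩⟩
  simp only [Finset.mem_filter, Finset.mem_powerset] at hU hUmin
  obtain ⟨hUR, hUcl, hUm⟩ := hU
  have hlt : ∀ W ⊆ U, closed W → W.card < U.card → (W.card : ℝ) < m := by
    intro W hW hWc hlt
    by_contra! h
    exact absurd (hUmin W ⟨hW.trans hUR, hWc, h⟩) (not_le.2 hlt)
  have hsep : ∀ W, W ⊆ R → closed W → m ≤ W.card → ((R \ W).card : ℝ) < m := by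
    intro W hWR hW hWm
    by_contra! h
    obtain ⟨u, hu, w, hw, huw⟩ := hlarge W (R \ W) Finset.disjoint_sdiff hWm h
    rw [Finset.mem_sdiff] at hw
    exact hw.2 (hW u hu w ((hmemR w).1 hw.1) huw)
  have hUne : U.Nonempty := by
    rw [← Finset.card_pos]
    have : (0 : ℝ) < U.card := hm.trans_le hUm
    exact_mod_cast this
  obtain ⟨u₀, hu₀⟩ := hUne
  have hu₀' := (hmem u₀).2 ((hmemR u₀).1 (hUR hu₀))
  set c₀ := H.connectedComponentMk ⟨u₀, hu₀'⟩ with hc₀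
  have hu₀c : u₀ ∈ comp c₀ := by
    simp only [comp, Finset.mem_filter, Finset.mem_univ, true_and]
    exact ⟨hu₀', rfl⟩
  have hcompR : comp c₀ ⊆ R := by
    intro v hv
    obtain ⟨h, -⟩ : ∃ h, H.connectedComponentMk ⟨v, h⟩ = c₀ := by simpa [comp] using hv
    exact (hmemR v).2 ((hmem v).1 h)
  have hUc : U ⊆ comp c₀ := by
    by_contra hne
    obtain ⟨v, hvU, hv⟩ := Finset.not_subset.1 hne
    have h1 : ((U \ comp c₀).card : ℝ) < m := by
      refine hlt _ Finset.sdiff_subset (hcl_diff U _ hUR hUcl (hcomp c₀)) ?_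
      exact Finset.card_lt_card (Finset.ssubset_iff_of_subset Finset.sdiff_subset |>.2
        ⟨u₀, hu₀, by simp [hu₀c]⟩)
    have h2 : ((U ∩ comp c₀).card : ℝ) < m := by
      refine hlt _ Finset.inter_subset_left ?_ ?_
      · intro u hu y hy huy
        rw [Finset.mem_inter] at hu ⊢
        exact ⟨hUcl u hu.1 y hy huy, hcomp c₀ u hu.2 y hy huy⟩
      · exact Finset.card_lt_card (Finset.ssubset_iff_of_subset Finset.inter_subset_left |>.2
          ⟨v, hvU, by simp [hv]⟩)
    have h3 : ((U \ comp c₀).card : ℝ) + (U ∩ comp c₀).card = U.card := by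
      exact_mod_cast Finset.card_sdiff_add_card_inter U (comp c₀)
    have h4 := hsep U hUR hUcl hUm
    have h5 : ((R \ U).card : ℝ) + U.card = R.card := by
      exact_mod_cast Finset.card_sdiff_add_card_eq_card hUR
    linarith
  set W := R \ comp c₀ with hW
  have hWm : (W.card : ℝ) < m := hsep _ hcompR (hcomp c₀)
    (hUm.trans (by exact_mod_cast Finset.card_le_card hUc))
  have hWR : W ⊆ R := Finset.sdiff_subset
  have hcount : Fintype.card H.ConnectedComponent ≤ W.card + 1 := by
    have hs : Function.Surjective (fun o : Option W => o.elim c₀ fun w =>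
        H.connectedComponentMk ⟨w.1, (hmem _).2 ((hmemR _).1 (hWR w.2))⟩) := by
      intro c
      obtain ⟨⟨v, hv⟩, rfl⟩ := hsurj c
      by_cases h : H.connectedComponentMk ⟨v, hv⟩ = c₀
      · exact ⟨none, h.symm⟩
      · refine ⟨some ⟨v, ?_⟩, rfl⟩
        rw [hW, Finset.mem_sdiff, hmemR]
        refine ⟨(hmem v).1 hv, fun hvc => h ?_⟩
        obtain ⟨h', hc⟩ : ∃ h, H.connectedComponentMk ⟨v, h⟩ = c₀ := by simpa [comp] using hvc
        exact hc
    have := Fintype.card_le_of_surjective _ hs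
    simpa using this
  have hSW : T.card ≤ W.card := by omega
  -- If `W` is empty then so is `S`, and the whole graph is a single component. It would have to be
  -- odd, against the even order.
  rcases W.eq_empty_or_nonempty with hWe | hWne
  · rw [hWe, Finset.card_empty, Nat.le_zero, Finset.card_eq_zero] at hSW
    have hSe : S = ∅ := by simpa [hT] using hSW
    have hpos : 0 < H.oddComponents.ncard := by omega
    obtain ⟨c, hc⟩ := (Set.ncard_pos).1 hpos
    have hall : ∀ v, H.connectedComponentMk v = c₀ := by
      rintro ⟨v, hv⟩
      have hvR : v ∈ R := (hmemR v).2 ((hmem v).1 hv)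
      have hvc : v ∈ comp c₀ := by
        by_contra h
        have : v ∈ W := Finset.mem_sdiff.2 ⟨hvR, h⟩
        rw [hWe] at this
        simp at this
      obtain ⟨h', hc⟩ : ∃ h, H.connectedComponentMk ⟨v, h⟩ = c₀ := by simpa [comp] using hvc
      exact hc
    have hsupp : c.supp = Set.univ := by
      ext v
      obtain ⟨w, rfl⟩ := hsurj c
      simp [SimpleGraph.ConnectedComponent.mem_supp_iff, hall]
    have h1 : Odd c.supp.ncard := hc
    rw [hsupp, Set.ncard_univ, Nat.card_eq_fintype_card, hverts, hR, hSW, Finset.compl_empty,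
      Finset.card_univ] at h1
    exact absurd heven (Nat.not_even_iff_odd.2 h1)
  · obtain ⟨w, hw, y, hyW, hyT, hwy⟩ := hsmall W T hWne hSW hWm.le
    have hyS : y ∉ S := by simpa [hT] using hyT
    exact hyW (hcl_diff R (comp c₀) subset_rfl hclR (hcomp c₀) w hw y hyS hwy)

/-- A version of `exists_isPerfectMatching_of_expansion` for the subgraph induced on `T`, with the
matching given as a graph on all vertices. -/
theorem exists_matching_of_expansion {V : Type*} [Fintype V] (G : SimpleGraph V) (T : Finset V)
    {m : ℝ} (hm : 0 < m) (heven : Even T.card) (hcard : 6 * m ≤ T.card)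
    (hsmall : ∀ W S : Finset V, W ⊆ T → S ⊆ T → W.Nonempty → S.card ≤ W.card →
      (W.card : ℝ) ≤ m → ∃ w ∈ W, ∃ y ∈ T, y ∉ W ∧ y ∉ S ∧ G.Adj w y)
    (hlarge : ∀ U W : Finset V, U ⊆ T → W ⊆ T → Disjoint U W → m ≤ U.card → m ≤ W.card →
      ∃ u ∈ U, ∃ w ∈ W, G.Adj u w) :
    ∃ F ≤ G, (∀ v ∈ T, (F.neighborSet v).ncard = 1) ∧ (∀ v w, F.Adj v w → v ∈ T) := by
  let e : T ↪ V := Function.Embedding.subtype _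
  have hmap : ∀ A : Finset T, A.map e ⊆ T := by
    intro A v hv
    obtain ⟨a, -, rfl⟩ := Finset.mem_map.1 hv
    exact a.2
  obtain ⟨M, hM⟩ := exists_isPerfectMatching_of_expansion (G.comap e) hm
    (by rwa [Fintype.card_coe]) (by rwa [Fintype.card_coe])
    (fun W S hW hS hWm => by
      obtain ⟨w, hw, y, hyT, hyW, hyS, hwy⟩ := hsmall (W.map e) (S.map e) (hmap W) (hmap S)
        (by simpa using hW) (by simpa using hS) (by simpa using hWm)
      obtain ⟨w, hw', rfl⟩ := Finset.mem_map.1 hw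
      refine ⟨w, hw', ⟨y, hyT⟩, fun h => hyW (Finset.mem_map.2 ⟨_, h, rfl⟩),
        fun h => hyS (Finset.mem_map.2 ⟨_, h, rfl⟩), hwy⟩)
    (fun U W hUW hU hW => by
      obtain ⟨u, hu, w, hw, huw⟩ := hlarge (U.map e) (W.map e) (hmap U) (hmap W)
        (by simpa using hUW) (by simpa using hU) (by simpa using hW)
      obtain ⟨w, hw', rfl⟩ := Finset.mem_map.1 hw
      obtain ⟨u, hu', rfl⟩ := Finset.mem_map.1 hu
      exact ⟨u, hu', w, hw', huw⟩)
  refine ⟨M.spanningCoe.map e, ?_, ?_, ?_⟩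
  · rintro _ _ h
    obtain ⟨a, b, hab, rfl, rfl⟩ := (SimpleGraph.map_adj _ _ _ _).1 h
    exact M.adj_sub hab
  · intro v hv
    obtain ⟨w, hw, huniq⟩ := SimpleGraph.Subgraph.isPerfectMatching_iff.1 hM ⟨v, hv⟩
    rw [Set.ncard_eq_one]
    refine ⟨e w, ?_⟩
    ext y
    rw [SimpleGraph.mem_neighborSet, Set.mem_singleton_iff, SimpleGraph.map_adj]
    constructor
    · rintro ⟨a, b, hab, ha, rfl⟩
      have : a = ⟨v, hv⟩ := Subtype.ext ha
      subst this
      rw [huniq b hab]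
    · rintro rfl
      exact ⟨⟨v, hv⟩, w, hw, rfl, rfl⟩
  · intro v w h
    obtain ⟨a, b, hab, rfl, rfl⟩ := (SimpleGraph.map_adj _ _ _ _).1 h
    exact a.2

end Matching

/-! ### Edge-disjoint factors with degrees 1 modulo `k`. -/

section Factors

variable {V : Type*} [Fintype V]

/-- The graph `G` with all edges at the vertices of `S` removed. -/
def isolate (G : SimpleGraph V) (S : Finset V) : SimpleGraph V where
  Adj a b := G.Adj a b ∧ a ∉ S ∧ b ∉ S
  symm := ⟨fun _ _ h => ⟨h.1.symm, h.2.2, h.2.1⟩⟩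
  loopless := ⟨fun _ h => h.1.ne rfl⟩

theorem ncard_neighborSet (G : SimpleGraph V) (v : V) :
    (G.neighborSet v).ncard = (Finset.univ.filter fun w => G.Adj v w).card := by
  rw [Set.ncard_eq_toFinset_card']
  congr 1
  ext w
  simp

/-- The vertices whose degree after isolating `S` is divisible by `k`. -/
noncomputable def zeroClass (G : SimpleGraph V) (k : ℕ) (S : Finset V) : Finset V :=
  Finset.univ.filter fun y => y ∉ S ∧
    ((Finset.univ.filter fun u => u ∉ S ∧ G.Adj y u).card : ZMod k) = 0

variable {G : SimpleGraph V} {k : ℕ} {d m Δ : ℝ}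

theorem PseudoRandom.lt_card_neighbors_zeroClass (hG : PseudoRandom G k d m Δ) {S : Finset V}
    (hS : S.card ≤ 1) (v : V) :
    d < ((zeroClass G k S).filter fun y => G.Adj v y).card := by
  refine (hG.spread S hS v 0).trans_le ?_
  norm_cast
  apply Finset.card_le_card
  intro y hy
  simp only [Finset.mem_filter, Finset.mem_univ, true_and, zeroClass] at hy ⊢
  exact ⟨⟨hy.1, hy.2.2⟩, hy.2.1⟩

/-- Since `T` contains the zero class up to `z` vertices and at most `L` edges per vertex were
deleted, more than `d / 2` neighbours in `T` remain at each vertex of `T`. The sparsity of small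
sets turns this into expansion, and deleting few edges cannot destroy all edges between large sets.
-/
theorem PseudoRandom.exists_matching (hG : PseudoRandom G k d m Δ) (hm : 0 < m) [Nonempty V]
    {S : Finset V} (hS : S.card ≤ 1) {L z : ℕ} (hL : (L : ℝ) ≤ Δ) (hd : 2 * (z + L : ℝ) ≤ d)
    {H : SimpleGraph V} (hHG : H ≤ isolate G S)
    (hrem : ∀ v, (Finset.univ.filter fun w => (isolate G S).Adj v w ∧ ¬ H.Adj v w).card ≤ L)
    {T Z : Finset V} (hTS : Disjoint T S) (hZ : Z.card ≤ z) (hBT : zeroClass G k S \ Z ⊆ T)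
    (heven : Even T.card) :
    ∃ F ≤ H, (∀ v ∈ T, (F.neighborSet v).ncard = 1) ∧ (∀ v w, F.Adj v w → v ∈ T) := by
  have hd0 : 0 ≤ d := le_trans (by positivity) hd
  have hTS' : ∀ v ∈ T, v ∉ S := fun v hv => Finset.disjoint_left.1 hTS hv
  have hdegT : ∀ v ∈ T, d / 2 < ((T.filter fun w => H.Adj v w).card : ℝ) := by
    intro v hv
    have h1 := hG.lt_card_neighbors_zeroClass hS v
    have h2 : ((zeroClass G k S).filter fun y => G.Adj v y) ⊆
        (T.filter fun w => H.Adj v w) ∪ (Z ∪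
          (Finset.univ.filter fun w => (isolate G S).Adj v w ∧ ¬ H.Adj v w)) := by
      intro y hy
      obtain ⟨hy1, hy2⟩ := Finset.mem_filter.1 hy
      have hyS : y ∉ S := (Finset.mem_filter.1 hy1).2.1
      by_cases hyZ : y ∈ Z
      · simp [hyZ]
      · have hyT : y ∈ T := hBT (Finset.mem_sdiff.2 ⟨hy1, hyZ⟩)
        by_cases hyH : H.Adj v y
        · simp [hyT, hyH]
        · have : (isolate G S).Adj v y := ⟨hy2, hTS' v hv, hyS⟩
          simp [hyH, this]
    have h3 : ((zeroClass G k S).filter fun y => G.Adj v y).card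
        ≤ (T.filter fun w => H.Adj v w).card + (z + L) :=
      (Finset.card_le_card h2).trans ((Finset.card_union_le _ _).trans
        (Nat.add_le_add_left ((Finset.card_union_le _ _).trans (Nat.add_le_add hZ (hrem v))) _))
    have h4 : (((zeroClass G k S).filter fun y => G.Adj v y).card : ℝ)
        ≤ (T.filter fun w => H.Adj v w).card + (z + L) := by exact_mod_cast h3
    linarith
  have hTne : T.Nonempty := by
    obtain ⟨v⟩ := ‹Nonempty V›
    have h1 := hG.lt_card_neighbors_zeroClass hS v
    by_contra hne
    rw [Finset.not_nonempty_iff_eq_empty] at hne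
    rw [hne, Finset.subset_empty, Finset.sdiff_eq_empty_iff_subset] at hBT
    have h2 : (((zeroClass G k S).filter fun y => G.Adj v y).card : ℝ) ≤ z := by
      exact_mod_cast (Finset.card_le_card ((Finset.filter_subset _ _).trans hBT)).trans hZ
    have : (0 : ℝ) ≤ L := by positivity
    have : (0 : ℝ) ≤ z := by positivity
    linarith
  -- Otherwise all these neighbours of `W` lie in `U`, giving degree sum at least `|W| d / 2 ≥ |U| d
  -- / 4` inside `U`, which `sparse` forbids.
  have hexpand : ∀ W U : Finset V, W ⊆ U → W ⊆ T → W.Nonempty → U.card ≤ 2 * W.card →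
      (U.card : ℝ) ≤ 8 * m → ∃ w ∈ W, ∃ y ∈ T, y ∉ U ∧ H.Adj w y := by
    intro W U hWU hWT hWne hcard hUm
    by_contra! hcon
    obtain ⟨w₀, hw₀⟩ := hWne
    have h1 := hG.sparse U ⟨w₀, hWU hw₀⟩ hUm
    have h2 : (W.card : ℝ) * (d / 2) ≤ ∑ u ∈ W, ((U.filter fun w => G.Adj u w).card : ℝ) := by
      rw [← nsmul_eq_mul]
      refine Finset.card_nsmul_le_sum _ _ _ fun w hw => (hdegT w (hWT hw)).le.trans ?_
      norm_cast
      apply Finset.card_le_card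
      intro y hy
      obtain ⟨hyT, hyH⟩ := Finset.mem_filter.1 hy
      refine Finset.mem_filter.2 ⟨?_, (hHG hyH).1⟩
      by_contra hyU
      exact hcon w hw y hyT hyU hyH
    have h3 : ∑ u ∈ W, ((U.filter fun w => G.Adj u w).card : ℝ)
        ≤ ∑ u ∈ U, ((U.filter fun w => G.Adj u w).card : ℝ) :=
      Finset.sum_le_sum_of_subset_of_nonneg hWU fun _ _ _ => Nat.cast_nonneg _
    have h4 : (U.card : ℝ) ≤ 2 * W.card := by exact_mod_cast hcard
    nlinarith
  refine exists_matching_of_expansion H T hm heven ?_ ?_ ?_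
  -- With `W = U = T` a neighbour in `T` outside `T` would exist, so `T` cannot be small.
  · by_contra! h
    obtain ⟨w, hw, y, hyT, hy, -⟩ := hexpand T T subset_rfl subset_rfl hTne (by omega)
      (by linarith)
    exact hy hyT
  · intro W A hWT hAT hWne hAW hWm
    have hc : (W ∪ A).card ≤ 2 * W.card := (Finset.card_union_le _ _).trans (by omega)
    have hc' : ((W ∪ A).card : ℝ) ≤ 2 * W.card := by exact_mod_cast hc
    obtain ⟨w, hw, y, hyT, hy, hwy⟩ := hexpand W (W ∪ A) Finset.subset_union_left hWT hWne hc
      (by linarith)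
    rw [Finset.mem_union, not_or] at hy
    exact ⟨w, hw, y, hyT, hy.1, hy.2, hwy⟩
  · intro U W hUT hWT hUW hUm hWm
    by_contra! hcon
    have h1 := hG.dense U W hUW hUm hWm
    have h2 : ∑ u ∈ U, ((W.filter fun w => G.Adj u w).card : ℝ) ≤ U.card * L := by
      rw [← nsmul_eq_mul]
      refine Finset.sum_le_card_nsmul _ _ _ fun u hu => ?_
      norm_cast
      refine (Finset.card_le_card ?_).trans (hrem u)
      intro w hw
      obtain ⟨hwW, huw⟩ := Finset.mem_filter.1 hw
      exact Finset.mem_filter.2 ⟨Finset.mem_univ _,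
        ⟨huw, hTS' u (hUT hu), hTS' w (hWT hwW)⟩, hcon u hu w hwW⟩
    have h3 : (U.card : ℝ) ≤ Fintype.card V := by exact_mod_cast Finset.card_le_univ U
    have h4 : (U.card : ℝ) * L ≤ Fintype.card V * Δ :=
      mul_le_mul h3 hL (by positivity) (by positivity)
    linarith

/-- A subgraph of `H` spanning `T` all of whose degrees are `1` modulo `k`. -/
theorem PseudoRandom.exists_factor (hG : PseudoRandom G k d m Δ) (hm : 0 < m) [Nonempty V]
    {S : Finset V} (hS : S.card ≤ 1) {L : ℕ} (hL : (L : ℝ) ≤ Δ) (hd : 2 * (k + 2 + L : ℝ) ≤ d)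
    {H : SimpleGraph V} (hHG : H ≤ isolate G S)
    (hrem : ∀ v, (Finset.univ.filter fun w => (isolate G S).Adj v w ∧ ¬ H.Adj v w).card ≤ L)
    {T : Finset V} (hTS : Disjoint T S) (hBT : zeroClass G k S ⊆ T)
    (hpar : Even T.card ∨ Odd k) :
    ∃ F ≤ H, (∀ v ∈ T, (F.neighborSet v).ncard ≡ 1 [MOD k]) ∧
      (∀ v, (F.neighborSet v).ncard ≤ k + 1) ∧ (∀ v w, F.Adj v w → v ∈ T) := by
  have hempty : ∀ (F : SimpleGraph V) (T : Finset V), (∀ v w, F.Adj v w → v ∈ T) →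
      ∀ v, v ∉ T → F.neighborSet v = ∅ := by
    intro F T hF v hv
    ext w
    simpa using fun h => hv (hF v w h)
  by_cases heven : Even T.card
  · obtain ⟨F, hFH, hF1, hF2⟩ := hG.exists_matching hm hS hL (z := k + 2)
      (by push_cast; linarith) hHG hrem hTS (Z := ∅) (by simp) (by simpa using hBT) heven
    refine ⟨F, hFH, fun v hv => by rw [hF1 v hv], fun v => ?_, hF2⟩
    by_cases hv : v ∈ T
    · rw [hF1 v hv]; omega
    · rw [hempty F T hF2 v hv, Set.ncard_empty]; omega
  · have hk : Odd k := hpar.resolve_left heven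
    have hd0 : (0 : ℝ) ≤ L := Nat.cast_nonneg _
    have hk0 : (0 : ℝ) ≤ k := Nat.cast_nonneg _
    have hTS' : ∀ v ∈ T, v ∉ S := fun v hv => Finset.disjoint_left.1 hTS hv
    obtain ⟨c, hc⟩ : (zeroClass G k S).Nonempty := by
      obtain ⟨v⟩ := ‹Nonempty V›
      have h1 := hG.lt_card_neighbors_zeroClass hS v
      have h2 : 0 < ((zeroClass G k S).filter fun y => G.Adj v y).card := by
        have : (0 : ℝ) < ((zeroClass G k S).filter fun y => G.Adj v y).card := by linarith
        exact_mod_cast this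
      exact (Finset.card_pos.1 h2).mono (Finset.filter_subset _ _)
    have hcT := hBT hc
    -- A star with centre `c` and leaf set `N`: the centre has degree `k + 1`, the leaves degree 1.
    -- It uses `k + 2` vertices, an odd number, so an even number of vertices of `T` remains to be
    -- matched.
    obtain ⟨N, hN, hNk⟩ : ∃ N ⊆ (zeroClass G k S).filter (fun y => H.Adj c y), N.card = k + 1 := by
      apply Finset.exists_subset_card_eq
      have h1 := hG.lt_card_neighbors_zeroClass hS c
      have h2 : ((zeroClass G k S).filter fun y => G.Adj c y).card ≤
          ((zeroClass G k S).filter (fun y => H.Adj c y)).card + L := by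
        refine le_trans (Finset.card_le_card ?_)
          ((Finset.card_union_le _ _).trans (Nat.add_le_add_left (hrem c) _))
        intro y hy
        obtain ⟨hy1, hy2⟩ := Finset.mem_filter.1 hy
        by_cases hyH : H.Adj c y
        · simp [hy1, hyH]
        · have : (isolate G S).Adj c y := ⟨hy2, hTS' c hcT, hTS' y (hBT hy1)⟩
          simp [hyH, this]
      have h3 : (((zeroClass G k S).filter fun y => G.Adj c y).card : ℝ) ≤
          ((zeroClass G k S).filter (fun y => H.Adj c y)).card + L := by exact_mod_cast h2
      have h4 : ((k + 1 : ℕ) : ℝ) ≤ ((zeroClass G k S).filter (fun y => H.Adj c y)).card := by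
        push_cast
        linarith
      exact_mod_cast h4
    have hNT : N ⊆ T := fun y hy => hBT (Finset.mem_filter.1 (hN hy)).1
    have hNH : ∀ y ∈ N, H.Adj c y := fun y hy => (Finset.mem_filter.1 (hN hy)).2
    have hcN : c ∉ N := fun h => (hNH c h).ne rfl
    have hZ : (insert c N).card = k + 2 := by rw [Finset.card_insert_of_notMem hcN, hNk]
    have hZT : insert c N ⊆ T := Finset.insert_subset hcT hNT
    have heven' : Even (T \ insert c N).card := by
      rw [Finset.card_sdiff_of_subset hZT, hZ, Nat.even_sub (hZ ▸ Finset.card_le_card hZT)]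
      simp only [heven, false_iff, Nat.not_even_iff_odd]
      exact hk.add_even even_two
    obtain ⟨F, hFH, hF1, hF2⟩ := hG.exists_matching hm hS hL (z := k + 2)
      (by push_cast; linarith) hHG hrem (hTS.mono_left (Finset.sdiff_subset (s := T) (t := insert c N)))
      (Z := insert c N) hZ.le (Finset.sdiff_subset_sdiff hBT subset_rfl) heven'
    let star : SimpleGraph V :=
      { Adj := fun a b => (a = c ∧ b ∈ N) ∨ (b = c ∧ a ∈ N)
        symm := ⟨fun a b h => h.symm⟩
        loopless := ⟨fun a h => by rcases h with ⟨rfl, h⟩ | ⟨rfl, h⟩ <;> exact hcN h⟩ }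
    have hnbr : ∀ v, (F ⊔ star).neighborSet v = F.neighborSet v ∪ star.neighborSet v := by
      intro v; ext w; simp
    have hF0 : ∀ v ∈ insert c N, F.neighborSet v = ∅ := fun v hv =>
      hempty F _ hF2 v fun h => (Finset.mem_sdiff.1 h).2 hv
    have hs0 : ∀ v, v ∉ insert c N → star.neighborSet v = ∅ := by
      intro v hv
      refine hempty star (insert c N) ?_ v hv
      rintro v w (⟨rfl, -⟩ | ⟨-, h⟩)
      · exact Finset.mem_insert_self _ _
      · exact Finset.mem_insert_of_mem h
    have hsc : (star.neighborSet c).ncard = k + 1 := by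
      have : star.neighborSet c = N := by
        ext w
        simp [star, hcN]
      rw [this, Set.ncard_coe_finset, hNk]
    have hsN : ∀ v ∈ N, (star.neighborSet v).ncard = 1 := by
      intro v hv
      have hvc : v ≠ c := fun h => hcN (h ▸ hv)
      have : star.neighborSet v = {c} := by
        ext w
        simp [star, hvc, hv]
      rw [this, Set.ncard_singleton]
    have hdeg : ∀ v, (v = c ∧ ((F ⊔ star).neighborSet v).ncard = k + 1) ∨
        (v ∈ T ∧ ((F ⊔ star).neighborSet v).ncard = 1) ∨
        (v ∉ T ∧ ((F ⊔ star).neighborSet v).ncard = 0) := by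
      intro v
      rw [hnbr]
      by_cases hvZ : v ∈ insert c N
      · rw [hF0 v hvZ, Set.empty_union]
        rcases Finset.mem_insert.1 hvZ with rfl | h
        · exact Or.inl ⟨rfl, hsc⟩
        · exact Or.inr (Or.inl ⟨hNT h, hsN v h⟩)
      · rw [hs0 v hvZ, Set.union_empty]
        by_cases hvT : v ∈ T
        · exact Or.inr (Or.inl ⟨hvT, hF1 v (Finset.mem_sdiff.2 ⟨hvT, hvZ⟩)⟩)
        · refine Or.inr (Or.inr ⟨hvT, ?_⟩)
          rw [hempty F _ hF2 v fun h => hvT (Finset.mem_sdiff.1 h).1, Set.ncard_empty]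
    refine ⟨F ⊔ star, sup_le hFH ?_, fun v hv => ?_, fun v => ?_, fun v w hvw => ?_⟩
    · rintro a b (⟨rfl, h⟩ | ⟨rfl, h⟩)
      · exact hNH b h
      · exact (hNH a h).symm
    · rcases hdeg v with ⟨-, h⟩ | ⟨-, h⟩ | ⟨h, -⟩
      · rw [h]; simp [Nat.ModEq]
      · rw [h]
      · exact absurd hv h
    · rcases hdeg v with ⟨-, h⟩ | ⟨-, h⟩ | ⟨-, h⟩ <;> omega
    · rcases hvw with h | ⟨rfl, -⟩ | ⟨-, h⟩
      · exact (Finset.mem_sdiff.1 (hF2 v w h)).1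
      · exact hcT
      · exact hNT h

/-- Edge-disjoint spanning subgraphs of prescribed sets, all of whose degrees are `1` modulo
`k`. -/
theorem PseudoRandom.exists_factors (hG : PseudoRandom G k d m Δ) (hm : 0 < m) [Nonempty V]
    {S : Finset V} (hS : S.card ≤ 1) (hΔ : (k * (k + 1) : ℝ) ≤ Δ)
    (hd : 2 * (k + 2 + k * (k + 1) : ℝ) ≤ d) (T : ℕ → Finset V) (j : ℕ) (hj : j ≤ k)
    (hT : ∀ i < j, Disjoint (T i) S ∧ zeroClass G k S ⊆ T i ∧ (Even (T i).card ∨ Odd k)) :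
    ∃ F : ℕ → SimpleGraph V, ∀ i < j, F i ≤ isolate G S ∧
      (∀ v ∈ T i, ((F i).neighborSet v).ncard ≡ 1 [MOD k]) ∧
      (∀ v, ((F i).neighborSet v).ncard ≤ k + 1) ∧ (∀ v w, (F i).Adj v w → v ∈ T i) ∧
      ∀ i' < i, ∀ v w, (F i).Adj v w → ¬ (F i').Adj v w := by
  induction j with
  | zero => exact ⟨fun _ => ⊥, fun i hi => absurd hi (Nat.not_lt_zero i)⟩
  | succ j ih =>
    obtain ⟨F, hF⟩ := ih (by omega) fun i hi => hT i (by omega)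
    obtain ⟨H, hH⟩ : ∃ H : SimpleGraph V, ∀ a b, H.Adj a b ↔
        (isolate G S).Adj a b ∧ ∀ i < j, ¬ (F i).Adj a b :=
      ⟨{ Adj := fun a b => (isolate G S).Adj a b ∧ ∀ i < j, ¬ (F i).Adj a b
         symm := ⟨fun a b h => ⟨h.1.symm, fun i hi hab => h.2 i hi hab.symm⟩⟩
         loopless := ⟨fun a h => h.1.ne rfl⟩ }, fun _ _ => Iff.rfl⟩
    -- At most `k` earlier factors, each of maximum degree at most `k + 1`, have been removed.
    have hrem : ∀ v, (Finset.univ.filter fun w => (isolate G S).Adj v w ∧ ¬ H.Adj v w).card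
        ≤ k * (k + 1) := by
      intro v
      have h1 : (Finset.univ.filter fun w => (isolate G S).Adj v w ∧ ¬ H.Adj v w)
          ⊆ (Finset.range j).biUnion fun i => Finset.univ.filter fun w => (F i).Adj v w := by
        intro w hw
        simp only [Finset.mem_filter, Finset.mem_univ, true_and, hH, not_and, not_forall,
          not_not] at hw
        obtain ⟨i, hi, h⟩ := hw.2 hw.1
        simp only [Finset.mem_biUnion, Finset.mem_range, Finset.mem_filter, Finset.mem_univ,
          true_and]
        exact ⟨i, hi, h⟩
      refine (Finset.card_le_card h1).trans ((Finset.card_biUnion_le_card_mul _ _ (k + 1) ?_).trans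
        (Nat.mul_le_mul_right _ (by rw [Finset.card_range]; omega)))
      intro i hi
      rw [← ncard_neighborSet]
      exact (hF i (Finset.mem_range.1 hi)).2.2.1 v
    obtain ⟨hT1, hT2, hT3⟩ := hT j (by omega)
    obtain ⟨E, hEH, hE1, hE2, hE3⟩ := hG.exists_factor hm hS (L := k * (k + 1))
      (by push_cast; exact hΔ) (by push_cast; exact hd) (H := H) (fun a b h => ((hH a b).1 h).1) hrem
      hT1 hT2 hT3
    refine ⟨fun i => if i = j then E else F i, fun i hi => ?_⟩
    rcases Nat.lt_succ_iff_lt_or_eq.1 hi with hij | rfl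
    · have hne : i ≠ j := hij.ne
      simp only [hne, if_false]
      obtain ⟨h1, h2, h3, h4, h5⟩ := hF i hij
      refine ⟨h1, h2, h3, h4, fun i' hi' => ?_⟩
      rw [if_neg (by omega)]
      exact h5 i' hi'
    · simp only [if_true]
      refine ⟨fun a b h => ((hH a b).1 (hEH h)).1, hE1, hE2, hE3, fun i' hi' v w h => ?_⟩
      rw [if_neg (by omega)]
      exact ((hH v w).1 (hEH h)).2 i' hi'

end Factors

/-! ### Prescribed residues and the upper bounds. -/

section Decomposition

variable {V : Type*}

/-- An ordinary vertex goes into the first `s v` classes. The vertices `y j` belong to one class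
each and are free to correct parities: `y j` joins class `j` if that class is odd so far, and class
0 otherwise. Class 0 is then even because the total is. -/
theorem exists_even_classes (W : Finset V) (s : V → ℕ) (q : ℕ) (hs : ∀ v ∈ W, s v ≤ q)
    (y : ℕ → V) (hinj : ∀ i < q, ∀ j < q, y i = y j → i = j)
    (hy : ∀ i < q, y i ∈ W ∧ s (y i) = 1) (heven : Even (∑ v ∈ W, s v)) :
    ∃ T : ℕ → Finset V, (∀ i < q, T i ⊆ W ∧ Even (T i).card) ∧
      ∀ v ∈ W, ((Finset.range q).filter fun i => v ∈ T i).card = s v := by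
  let B : ℕ → Finset V := fun i => W.filter fun v => (∀ j < q, v ≠ y j) ∧ i < s v
  let t : ℕ → ℕ := fun j => if Odd (B j).card then j else 0
  let T : ℕ → Finset V := fun i =>
    W.filter fun v => ((∀ j < q, v ≠ y j) ∧ i < s v) ∨ ∃ j < q, v = y j ∧ i = t j
  have hcount : ∀ v ∈ W, ((Finset.range q).filter fun i => v ∈ T i).card = s v := by
    intro v hv
    by_cases h : ∃ j < q, v = y j
    · obtain ⟨j, hj, rfl⟩ := h
      have h1 : ((Finset.range q).filter fun i => y j ∈ T i) = {t j} := by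
        ext i
        simp only [Finset.mem_filter, Finset.mem_range, Finset.mem_singleton, T, hv, true_and]
        constructor
        · rintro ⟨-, ⟨h, -⟩ | ⟨j', hj', h, rfl⟩⟩
          · exact absurd rfl (h j hj)
          · rw [hinj j hj j' hj' h]
        · rintro rfl
          refine ⟨?_, Or.inr ⟨j, hj, rfl, rfl⟩⟩
          simp only [t]
          split_ifs <;> omega
      rw [h1, (hy j hj).2, Finset.card_singleton]
    · have h0 : ∀ j < q, v ≠ y j := fun j hj hvj => h ⟨j, hj, hvj⟩
      have h1 : ((Finset.range q).filter fun i => v ∈ T i) = Finset.range (s v) := by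
        ext i
        simp only [Finset.mem_filter, Finset.mem_range, T, hv, true_and]
        constructor
        · rintro ⟨-, ⟨-, h'⟩ | ⟨j, hj, h', -⟩⟩
          · exact h'
          · exact absurd h' (h0 j hj)
        · intro hi
          exact ⟨hi.trans_le (hs v hv), Or.inl ⟨h0, hi⟩⟩
      rw [h1, Finset.card_range]
  have hpos : ∀ i < q, i ≠ 0 → Even (T i).card := by
    intro i hi hi0
    by_cases hB : Odd (B i).card
    · have h1 : T i = insert (y i) (B i) := by
        ext v
        simp only [T, B, Finset.mem_filter, Finset.mem_insert]
        constructor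
        · rintro ⟨hv, h | ⟨j, hj, rfl, h⟩⟩
          · exact Or.inr ⟨hv, h⟩
          · left
            simp only [t] at h
            split_ifs at h
            · rw [h]
            · exact absurd h hi0
        · rintro (rfl | ⟨hv, h⟩)
          · refine ⟨(hy i hi).1, Or.inr ⟨i, hi, rfl, ?_⟩⟩
            simp only [t]
            rw [if_pos hB]
          · exact ⟨hv, Or.inl h⟩
      have h2 : y i ∉ B i := fun h => ((Finset.mem_filter.1 h).2.1 i hi) rfl
      rw [h1, Finset.card_insert_of_notMem h2]
      exact hB.add_one
    · have h1 : T i = B i := by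
        ext v
        simp only [T, B, Finset.mem_filter]
        constructor
        · rintro ⟨hv, h | ⟨j, hj, rfl, h⟩⟩
          · exact ⟨hv, h⟩
          · simp only [t] at h
            split_ifs at h with h'
            · subst h
              exact absurd h' hB
            · exact absurd h hi0
        · rintro ⟨hv, h⟩
          exact ⟨hv, Or.inl h⟩
      rw [h1]
      exact Nat.not_odd_iff_even.1 hB
  refine ⟨T, fun i hi => ⟨Finset.filter_subset _ _, ?_⟩, hcount⟩
  by_cases hi0 : i = 0
  · subst hi0
    have h1 : ∑ i ∈ Finset.range q, (T i).card = ∑ v ∈ W, s v := by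
      rw [← Finset.sum_congr rfl hcount]
      simp only [Finset.card_filter]
      rw [Finset.sum_comm]
      refine Finset.sum_congr rfl fun i _ => ?_
      rw [← Finset.card_filter]
      congr 1
      ext v
      simp only [Finset.mem_filter, T]
      tauto
    rw [← Finset.add_sum_erase _ _ (Finset.mem_range.2 hi)] at h1
    rw [← h1, Nat.even_add] at heven
    refine heven.2 (Finset.even_sum _ fun i hi => ?_)
    rw [Finset.mem_erase, Finset.mem_range] at hi
    exact hpos i hi.2 hi.1
  · exact hpos i hi hi0

/-- `F` decomposes `G` into edge-disjoint subgraphs all of whose non-zero degrees are `1`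
modulo `k`. -/
structure IsModDecomposition (G : SimpleGraph V) (k : ℕ) {K : Type*} (F : K → SimpleGraph V) :
    Prop where
  adj_iff : ∀ a b, G.Adj a b ↔ ∃ i, (F i).Adj a b
  eq_of_adj : ∀ i j a b, (F i).Adj a b → (F j).Adj a b → i = j
  modEq : ∀ i v, ((F i).neighborSet v).Nonempty → ((F i).neighborSet v).ncard ≡ 1 [MOD k]

theorem IsModDecomposition.modEdgeColorable {G : SimpleGraph V} {k r : ℕ} {K : Type*} [Fintype K]
    {F : K → SimpleGraph V} (hF : IsModDecomposition G k F) (hr : Fintype.card K = r) :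
    G.ModEdgeColorable k r := by
  let e : K ≃ Fin r := Fintype.equivFinOfCardEq hr
  have hex : ∀ x : G.edgeSet, ∃ i, x.1 ∈ (F i).edgeSet := by
    rintro ⟨x, hx⟩
    induction x using Sym2.inductionOn with
    | _ a b => exact (hF.adj_iff a b).1 hx
  let c : G.EdgeLabeling (Fin r) := fun x => e (hex x).choose
  have hc : ∀ i, c.labelGraph i = F (e.symm i) := by
    intro i
    ext a b
    rw [SimpleGraph.EdgeLabeling.labelGraph_adj]
    constructor
    · rintro ⟨h, rfl⟩
      simpa [c] using (hex ⟨s(a, b), h⟩).choose_spec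
    · intro h
      have hG : G.Adj a b := (hF.adj_iff a b).2 ⟨_, h⟩
      refine ⟨hG, ?_⟩
      have h1 := (hex ⟨s(a, b), hG⟩).choose_spec
      rw [← Equiv.eq_symm_apply]
      exact hF.eq_of_adj _ _ a b h1 h
  refine ⟨c, fun i v hv => ?_⟩
  rw [hc] at hv ⊢
  exact hF.modEq _ v hv

variable [Fintype V] {G : SimpleGraph V} {k : ℕ} {d m Δ : ℝ}

/-- The `k - 1` factors use up `s v`, the residue of `D v - 1`, at each vertex `v` outside `S`, so
the remaining graph has all degrees there congruent to 1; it is the colour `none`. -/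
theorem PseudoRandom.exists_isModDecomposition_isolate (hG : PseudoRandom G k d m Δ) (hm : 0 < m)
    [Nonempty V] {S : Finset V} (hS : S.card ≤ 1) (hk : 2 ≤ k) (hΔ : (k * (k + 1) : ℝ) ≤ Δ)
    (hd : 2 * (k + 2 + k * (k + 1) : ℝ) ≤ d) (hpar : Even Sᶜ.card ∨ Odd k) :
    ∃ F : Option (Fin (k - 1)) → SimpleGraph V, IsModDecomposition (isolate G S) k F := by
  have : NeZero k := ⟨by omega⟩
  let D : V → ℕ := fun v => (Finset.univ.filter fun u => (isolate G S).Adj v u).card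
  have hD : ∀ v, v ∉ S → D v = (Finset.univ.filter fun u => u ∉ S ∧ G.Adj v u).card := by
    intro v hv
    simp only [D]
    congr 1
    ext u
    simp [isolate, hv, and_comm]
  -- Adding `k - 1` instead of subtracting 1 avoids truncated subtraction at isolated vertices.
  let s : V → ℕ := fun v => (D v + (k - 1)) % k
  have hsk : ∀ v, s v < k := fun v => Nat.mod_lt _ (by omega)
  have hscast : ∀ v, (s v : ZMod k) = D v - 1 := by
    intro v
    simp only [s]
    rw [ZMod.natCast_mod, Nat.cast_add, Nat.cast_sub (by omega), ZMod.natCast_self]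
    ring
  have hseq : ∀ v (a : ℕ), a < k → (D v : ZMod k) = a + 1 → s v = a := by
    intro v a ha h
    have h1 : (s v : ZMod k) = a := by rw [hscast, h]; ring
    rw [ZMod.natCast_eq_natCast_iff] at h1
    exact Nat.ModEq.eq_of_lt_of_lt h1 (hsk v) ha
  have hT : ∃ T : ℕ → Finset V, (∀ i < k - 1, T i ⊆ Sᶜ ∧ (Even (T i).card ∨ Odd k)) ∧
      ∀ v ∈ Sᶜ, ((Finset.range (k - 1)).filter fun i => v ∈ T i).card = s v := by
    by_cases hodd : Odd k
    · refine ⟨fun i => Sᶜ.filter fun v => i < s v, fun i _ => ⟨Finset.filter_subset _ _,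
        Or.inr hodd⟩, fun v hv => ?_⟩
      have h1 : ((Finset.range (k - 1)).filter fun i => v ∈ Sᶜ.filter fun v => i < s v)
          = Finset.range (s v) := by
        ext i
        have := hsk v
        simp only [Finset.mem_filter, Finset.mem_range, hv, true_and]
        omega
      rw [h1, Finset.card_range]
    · have hkeven : Even k := Nat.not_odd_iff_even.1 hodd
      have hSeven := hpar.resolve_right hodd
      obtain ⟨v₀⟩ := ‹Nonempty V›
      -- Vertices of degree 2 modulo `k` have `s = 1` and supply the parity correctors, one for each
      -- of the `k - 1` classes.
      have h1 := hG.spread S hS v₀ 2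
      set A := (Finset.univ.filter fun y => y ∉ S ∧ G.Adj v₀ y ∧
        ((Finset.univ.filter fun u => u ∉ S ∧ G.Adj y u).card : ZMod k) = 2) with hA
      have hAcard : k - 1 ≤ A.card := by
        have h2 : ((k - 1 : ℕ) : ℝ) ≤ A.card := by
          have : ((k - 1 : ℕ) : ℝ) ≤ k := by exact_mod_cast Nat.sub_le k 1
          have : (0 : ℝ) ≤ k := Nat.cast_nonneg _
          have : (0 : ℝ) ≤ k * (k + 1) := by positivity
          linarith
        exact_mod_cast h2
      obtain ⟨y⟩ := Function.Embedding.nonempty_of_card_le (α := Fin (k - 1)) (β := A)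
        (by rwa [Fintype.card_fin, Fintype.card_coe])
      -- For even `k` reduction modulo `k` preserves parity, so the sum has the parity of the degree
      -- sum plus the number of vertices outside `S`; both are even.
      have hsum : Even (∑ v ∈ Sᶜ, s v) := by
        have h2 : ∀ v, (s v : ZMod 2) = D v + 1 := by
          intro v
          have hk2 : (k : ZMod 2) = 0 := (ZMod.natCast_eq_zero_iff _ _).2 hkeven.two_dvd
          have h3 := congrArg (Nat.cast (R := ZMod 2)) (Nat.mod_add_div (D v + (k - 1)) k)
          push_cast at h3
          rw [Nat.cast_sub (by omega), hk2, zero_mul, add_zero, Nat.cast_one, zero_sub] at h3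
          simp only [s]
          rw [h3]
          congr 1
        have h3 : ((∑ v ∈ Sᶜ, s v : ℕ) : ZMod 2) = ((∑ v ∈ Sᶜ, D v + Sᶜ.card : ℕ) : ZMod 2) := by
          push_cast
          simp only [h2]
          rw [Finset.sum_add_distrib, Finset.sum_const, nsmul_eq_mul, mul_one]
        have h4 : Even (∑ v ∈ Sᶜ, D v) := by
          have h5 : ∑ v ∈ Sᶜ, D v = ∑ v, (isolate G S).degree v := by
            have h6 : ∀ v, D v = (isolate G S).degree v := by
              intro v
              rw [← SimpleGraph.card_neighborFinset_eq_degree, SimpleGraph.neighborFinset_eq_filter]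
            rw [← Finset.sum_add_sum_compl Sᶜ]
            simp only [h6]
            rw [left_eq_add, Finset.sum_eq_zero]
            intro v hv
            rw [← h6]
            simp only [D]
            rw [Finset.card_eq_zero, Finset.filter_eq_empty_iff]
            intro u _ h
            simp only [compl_compl] at hv
            exact h.2.1 hv
          rw [h5, SimpleGraph.sum_degrees_eq_twice_card_edges]
          exact even_two_mul _
        have h5 : ((∑ v ∈ Sᶜ, s v : ℕ) : ZMod 2) = 0 := by
          rw [h3, ZMod.natCast_eq_zero_iff]
          exact (h4.add hSeven).two_dvd
        rw [ZMod.natCast_eq_zero_iff] at h5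
        exact even_iff_two_dvd.2 h5
      obtain ⟨T, hT1, hT2⟩ := exists_even_classes Sᶜ s (k - 1)
        (fun v _ => by have := hsk v; omega)
        (fun i => if h : i < k - 1 then (y ⟨i, h⟩).1 else v₀)
        (fun i hi j hj h => by
          simp only [hi, hj, dif_pos] at h
          simpa using y.injective (Subtype.ext h))
        (fun i hi => by
          simp only [hi, dif_pos]
          have h2 := (Finset.mem_filter.1 (y ⟨i, hi⟩).2).2
          refine ⟨Finset.mem_compl.2 h2.1, hseq _ 1 (by omega) ?_⟩
          rw [hD _ h2.1, h2.2.2]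
          norm_num) hsum
      exact ⟨T, fun i hi => ⟨(hT1 i hi).1, Or.inl (hT1 i hi).2⟩, hT2⟩
  obtain ⟨T, hT1, hT2⟩ := hT
  -- Degree 0 modulo `k` means `s v = k - 1`, so `v` belongs to all `k - 1` classes.
  have hzero : ∀ i < k - 1, zeroClass G k S ⊆ T i := by
    intro i hi v hv
    obtain ⟨-, hvS, hv0⟩ := Finset.mem_filter.1 hv
    have h1 : s v = k - 1 := hseq v (k - 1) (by omega) (by
      rw [hD v hvS, hv0, Nat.cast_sub (by omega), ZMod.natCast_self]
      push_cast
      ring)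
    have h2 := hT2 v (Finset.mem_compl.2 hvS)
    rw [h1] at h2
    have h3 := (Finset.card_filter_eq_iff (s := Finset.range (k - 1))).1
      (by rw [h2, Finset.card_range])
    exact h3 i (Finset.mem_range.2 hi)
  obtain ⟨F, hF⟩ := hG.exists_factors hm hS hΔ hd T (k - 1) (by omega) fun i hi =>
    ⟨Finset.disjoint_left.2 fun v hv => Finset.mem_compl.1 ((hT1 i hi).1 hv), hzero i hi,
      (hT1 i hi).2⟩
  obtain ⟨R, hR⟩ : ∃ R : SimpleGraph V, ∀ a b, R.Adj a b ↔
      (isolate G S).Adj a b ∧ ∀ i < k - 1, ¬ (F i).Adj a b :=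
    ⟨{ Adj := fun a b => (isolate G S).Adj a b ∧ ∀ i < k - 1, ¬ (F i).Adj a b
       symm := ⟨fun a b h => ⟨h.1.symm, fun i hi hab => h.2 i hi hab.symm⟩⟩
       loopless := ⟨fun a h => h.1.ne rfl⟩ }, fun _ _ => Iff.rfl⟩
  have hFF : ∀ i < k - 1, ∀ j < k - 1, ∀ a b, (F i).Adj a b → (F j).Adj a b → i = j := by
    intro i hi j hj a b hia hja
    rcases lt_trichotomy i j with h | h | h
    · exact absurd hia ((hF j hj).2.2.2.2 i h a b hja)
    · exact h
    · exact absurd hja ((hF i hi).2.2.2.2 j h a b hia)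
  have hdegF : ∀ i < k - 1, ∀ v,
      (((F i).neighborSet v).ncard : ZMod k) = if v ∈ T i then 1 else 0 := by
    intro i hi v
    obtain ⟨-, h2, -, h4, -⟩ := hF i hi
    split_ifs with h
    · have := (ZMod.natCast_eq_natCast_iff _ _ _).2 (h2 v h)
      simpa using this
    · have : (F i).neighborSet v = ∅ := by
        ext w
        simpa using fun hw => h (h4 v w hw)
      rw [this]
      simp
  have hdegR : ∀ v, v ∉ S → (R.neighborSet v).ncard ≡ 1 [MOD k] := by
    intro v hv
    have h1 : D v = (R.neighborSet v).ncard
        + ∑ i ∈ Finset.range (k - 1), ((F i).neighborSet v).ncard := by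
      simp only [D, ncard_neighborSet, Finset.card_filter]
      rw [Finset.sum_comm, ← Finset.sum_add_distrib]
      refine Finset.sum_congr rfl fun w _ => ?_
      by_cases hw : ∃ i < k - 1, (F i).Adj v w
      · obtain ⟨i, hi, h⟩ := hw
        have hRn : ¬ R.Adj v w := fun hR' => ((hR v w).1 hR').2 i hi h
        have hH : (isolate G S).Adj v w := (hF i hi).1 h
        rw [if_pos hH, if_neg hRn, zero_add,
          Finset.sum_eq_single_of_mem i (Finset.mem_range.2 hi), if_pos h]
        intro j hj hji
        rw [if_neg]
        exact fun hj' => hji (hFF j (Finset.mem_range.1 hj) i hi v w hj' h)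
      · have h0 : ∀ i < k - 1, ¬ (F i).Adj v w := fun i hi h => hw ⟨i, hi, h⟩
        rw [Finset.sum_eq_zero fun i hi => if_neg (h0 i (Finset.mem_range.1 hi)), add_zero]
        have : R.Adj v w ↔ (isolate G S).Adj v w := by
          rw [hR]; exact ⟨fun h => h.1, fun h => ⟨h, h0⟩⟩
        simp only [this]
    have h2 := congrArg (Nat.cast (R := ZMod k)) h1
    push_cast at h2
    rw [Finset.sum_congr rfl fun i hi => hdegF i (Finset.mem_range.1 hi) v, Finset.sum_boole,
      hT2 v (Finset.mem_compl.2 hv), hscast] at h2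
    rw [← ZMod.natCast_eq_natCast_iff, Nat.cast_one]
    linear_combination -h2
  refine ⟨fun o => o.elim R fun i => F i, ?_, ?_, ?_⟩
  · intro a b
    constructor
    · intro h
      by_cases hw : ∃ i < k - 1, (F i).Adj a b
      · obtain ⟨i, hi, h⟩ := hw
        exact ⟨some ⟨i, hi⟩, h⟩
      · exact ⟨none, (hR a b).2 ⟨h, fun i hi h => hw ⟨i, hi, h⟩⟩⟩
    · rintro ⟨_ | ⟨i, hi⟩, h⟩
      · exact ((hR a b).1 h).1
      · exact (hF i hi).1 h
  · rintro (_ | ⟨i, hi⟩) (_ | ⟨j, hj⟩) a b h1 h2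
    · rfl
    · exact absurd h2 (((hR a b).1 h1).2 j hj)
    · exact absurd h1 (((hR a b).1 h2).2 i hi)
    · have := hFF i hi j hj a b h1 h2
      subst this
      rfl
  · rintro (_ | ⟨i, hi⟩) v ⟨w, hw⟩
    · exact hdegR v ((hR v w).1 hw).1.2.1
    · exact (hF i hi).2.1 v ((hF i hi).2.2.2.1 v w hw)

theorem PseudoRandom.modEdgeColorable (hG : PseudoRandom G k d m Δ) (hm : 0 < m)
    [Nonempty V] (hk : 2 ≤ k) (hΔ : (k * (k + 1) : ℝ) ≤ Δ)
    (hd : 2 * (k + 2 + k * (k + 1) : ℝ) ≤ d) (hpar : Even (Fintype.card V) ∨ Odd k) :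
    G.ModEdgeColorable k k := by
  obtain ⟨F, hF⟩ := hG.exists_isModDecomposition_isolate hm (S := ∅) (by simp) hk hΔ hd
    (by simpa using hpar)
  have h : isolate G ∅ = G := by ext a b; simp [isolate]
  rw [h] at hF
  exact hF.modEdgeColorable (by rw [Fintype.card_option, Fintype.card_fin]; omega)

/-- All edges at a vertex `x` of degree 1 modulo `k` form one colour class, since the other ends
have degree 1 in it. Without `x` the order is even, and `k` further colours suffice. -/
theorem PseudoRandom.modEdgeColorable_succ (hG : PseudoRandom G k d m Δ) (hm : 0 < m)
    [Nonempty V] (hk : 2 ≤ k) (hΔ : (k * (k + 1) : ℝ) ≤ Δ)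
    (hd : 2 * (k + 2 + k * (k + 1) : ℝ) ≤ d) (hodd : Odd (Fintype.card V)) :
    G.ModEdgeColorable k (k + 1) := by
  have : NeZero k := ⟨by omega⟩
  obtain ⟨x, hx⟩ : ∃ x, (G.neighborSet x).ncard ≡ 1 [MOD k] := by
    obtain ⟨v⟩ := ‹Nonempty V›
    have h1 := hG.spread ∅ (by simp) v 1
    have h2 : (0 : ℝ) ≤ k * (k + 1) := by positivity
    have h3 : (0 : ℝ) ≤ k := Nat.cast_nonneg _
    have h4 : (0 : ℝ) < (Finset.univ.filter fun y => y ∉ (∅ : Finset V) ∧ G.Adj v y ∧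
      ((Finset.univ.filter fun u => u ∉ (∅ : Finset V) ∧ G.Adj y u).card : ZMod k) = 1).card := by
      linarith
    obtain ⟨x, hx⟩ := Finset.card_pos.1 (by exact_mod_cast h4)
    refine ⟨x, ?_⟩
    have h5 := (Finset.mem_filter.1 hx).2.2.2
    rw [← ZMod.natCast_eq_natCast_iff, ncard_neighborSet, Nat.cast_one]
    simpa using h5
  obtain ⟨F, hF⟩ := hG.exists_isModDecomposition_isolate hm (S := {x}) (by simp) hk hΔ hd (by
    left
    rw [Finset.card_compl, Finset.card_singleton]
    exact hodd.tsub_odd odd_one)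
  let E : SimpleGraph V :=
    { Adj := fun a b => G.Adj a b ∧ (a = x ∨ b = x)
      symm := ⟨fun a b h => ⟨h.1.symm, h.2.symm⟩⟩
      loopless := ⟨fun a h => h.1.ne rfl⟩ }
  have hFx : ∀ i a b, (F i).Adj a b → G.Adj a b ∧ a ≠ x ∧ b ≠ x := by
    intro i a b h
    have := (hF.adj_iff a b).2 ⟨i, h⟩
    simpa [isolate] using this
  have hE : IsModDecomposition G k (fun o : Option (Option (Fin (k - 1))) => o.elim E F) := by
    refine ⟨fun a b => ⟨fun h => ?_, ?_⟩, ?_, ?_⟩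
    · by_cases hab : a = x ∨ b = x
      · exact ⟨none, h, hab⟩
      · rw [not_or] at hab
        obtain ⟨i, hi⟩ := (hF.adj_iff a b).1 ⟨h, by simpa using hab.1, by simpa using hab.2⟩
        exact ⟨some i, hi⟩
    · rintro ⟨_ | i, h⟩
      · exact h.1
      · exact (hFx i a b h).1
    · rintro (_ | i) (_ | j) a b h1 h2
      · rfl
      · have := hFx j a b h2
        exact absurd h1.2 (by tauto)
      · have := hFx i a b h1
        exact absurd h2.2 (by tauto)
      · rw [hF.eq_of_adj i j a b h1 h2]
    · rintro (_ | i) v hv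
      · change (E.neighborSet v).ncard ≡ 1 [MOD k]
        by_cases hvx : v = x
        · subst hvx
          have : E.neighborSet v = G.neighborSet v := by
            ext w
            simp [E]
          rwa [this]
        · obtain ⟨w, hw⟩ := hv
          have hwx : w = x := hw.2.resolve_left hvx
          subst hwx
          have : E.neighborSet v = {w} := by
            ext u
            simp only [SimpleGraph.mem_neighborSet, Set.mem_singleton_iff]
            constructor
            · exact fun h => h.2.resolve_left hvx
            · rintro rfl
              exact hw
          rw [this, Set.ncard_singleton]
      · exact hF.modEq i v hv
  exact hE.modEdgeColorable (by simp only [Fintype.card_option, Fintype.card_fin]; omega)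

end Decomposition

/-! ### Lower bounds on the number of colours. -/

section LowerBound

theorem SimpleGraph.modChromaticIndex_eq {V : Type*} {G : SimpleGraph V} {k r : ℕ}
    (h : G.ModEdgeColorable k r) (hmin : ∀ r' < r, ¬ G.ModEdgeColorable k r') :
    G.modChromaticIndex k = (r : ℕ∞) := by
  refine le_antisymm (iInf₂_le r h) (le_iInf₂ fun r' hr' => ?_)
  by_contra! hlt
  exact hmin r' (by exact_mod_cast hlt) hr'

variable {V : Type*} [Fintype V] {G : SimpleGraph V} {k : ℕ}

/-- Modulo `k`, the degree of a vertex is the number of colours it sees. -/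
theorem SimpleGraph.IsModColoring.natCast_degree {r : ℕ} {c : G.EdgeLabeling (Fin r)}
    (hc : SimpleGraph.IsModColoring k c) (v : V) :
    ((Finset.univ.filter fun w => G.Adj v w).card : ZMod k)
      = ((Finset.univ.filter fun i => ((c.labelGraph i).neighborSet v).Nonempty).card : ZMod k) := by
  have h1 : (Finset.univ.filter fun w => G.Adj v w).card
      = ∑ i, ((c.labelGraph i).neighborSet v).ncard := by
    simp only [ncard_neighborSet, Finset.card_filter]
    rw [Finset.sum_comm]
    refine Finset.sum_congr rfl fun w _ => ?_
    by_cases h : G.Adj v w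
    · rw [if_pos h, Finset.sum_eq_single_of_mem (c ⟨s(v, w), h⟩) (Finset.mem_univ _), if_pos]
      · rw [SimpleGraph.EdgeLabeling.labelGraph_adj]
        exact ⟨h, rfl⟩
      · intro j _ hj
        rw [if_neg]
        rw [SimpleGraph.EdgeLabeling.labelGraph_adj]
        rintro ⟨_, h'⟩
        exact hj h'.symm
    · rw [if_neg h, Finset.sum_eq_zero]
      intro i _
      rw [if_neg]
      rw [SimpleGraph.EdgeLabeling.labelGraph_adj]
      rintro ⟨h', _⟩
      exact h h'
  rw [h1, Nat.cast_sum, Finset.card_filter, Nat.cast_sum]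
  refine Finset.sum_congr rfl fun i _ => ?_
  split_ifs with h
  · exact (ZMod.natCast_eq_natCast_iff _ _ _).2 (hc i v h)
  · rw [Set.not_nonempty_iff_eq_empty.1 h, Set.ncard_empty]

variable {d m Δ : ℝ}

theorem PseudoRandom.exists_adj_natCast_degree_eq (hG : PseudoRandom G k d m Δ) (hd : 0 ≤ d)
    (v : V) (a : ZMod k) :
    ∃ y, G.Adj v y ∧ ((Finset.univ.filter fun w => G.Adj y w).card : ZMod k) = a := by
  have h1 := hd.trans_lt (hG.spread ∅ (by simp) v a)
  obtain ⟨y, hy⟩ := Finset.card_pos.1 (by exact_mod_cast h1)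
  have h2 := (Finset.mem_filter.1 hy).2
  exact ⟨y, h2.2.1, by simpa using h2.2.2⟩

theorem PseudoRandom.not_modEdgeColorable_of_lt (hG : PseudoRandom G k d m Δ) (hd : 0 ≤ d)
    [Nonempty V] {r : ℕ} (hr : r < k) : ¬ G.ModEdgeColorable k r := by
  rintro ⟨c, hc⟩
  obtain ⟨v⟩ := ‹Nonempty V›
  obtain ⟨y, hvy, hy⟩ := hG.exists_adj_natCast_degree_eq hd v 0
  rw [hc.natCast_degree, ZMod.natCast_eq_zero_iff] at hy
  have hne : (Finset.univ.filter fun i => ((c.labelGraph i).neighborSet y).Nonempty).Nonempty := by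
    refine ⟨c ⟨s(y, v), hvy.symm⟩, Finset.mem_filter.2 ⟨Finset.mem_univ _, v, ?_⟩⟩
    rw [SimpleGraph.mem_neighborSet, SimpleGraph.EdgeLabeling.labelGraph_adj]
    exact ⟨hvy.symm, rfl⟩
  have h1 := Nat.le_of_dvd (Finset.card_pos.2 hne) hy
  have h2 := Finset.card_le_univ
    (Finset.univ.filter fun i => ((c.labelGraph i).neighborSet y).Nonempty)
  rw [Fintype.card_fin] at h2
  omega

theorem PseudoRandom.not_modEdgeColorable_of_odd (hG : PseudoRandom G k d m Δ) (hd : 0 ≤ d)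
    (hm : 0 < m) (hΔ : 0 ≤ Δ) (hk : 2 ≤ k) (hkeven : Even k) (hodd : Odd (Fintype.card V)) :
    ¬ G.ModEdgeColorable k k := by
  rintro ⟨c, hc⟩
  have : NeZero k := ⟨by omega⟩
  set A : Finset V := Finset.univ.filter fun v =>
    ((Finset.univ.filter fun w => G.Adj v w).card : ZMod k) = 1 with hA
  -- The number of colours seen is at most `k` and congruent to 1 modulo `k`; it is 1 because `k ≥
  -- 2` excludes `k` itself.
  have hone : ∀ v ∈ A, ∀ i j, ((c.labelGraph i).neighborSet v).Nonempty →
      ((c.labelGraph j).neighborSet v).Nonempty → i = j := by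
    intro v hv i j hi hj
    have h1 := (Finset.mem_filter.1 hv).2
    rw [hc.natCast_degree] at h1
    set N := (Finset.univ.filter fun i => ((c.labelGraph i).neighborSet v).Nonempty) with hN
    have h2 : N.card ≤ k := by simpa using Finset.card_le_univ N
    have h3 : N.card ≡ 1 [MOD k] := by
      rw [← ZMod.natCast_eq_natCast_iff, h1, Nat.cast_one]
    have h4 : N.card = 1 := by
      rcases h2.lt_or_eq with h2 | h2
      · exact Nat.ModEq.eq_of_lt_of_lt h3 h2 (by omega)
      · rw [h2, Nat.ModEq, Nat.mod_self, Nat.mod_eq_of_lt (by omega)] at h3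
        exact absurd h3 (by norm_num)
    exact Finset.card_le_one.1 h4.le i (by simpa [hN] using hi) j (by simpa [hN] using hj)
  have hadj : ∀ v w, G.Adj v w → ∃ i, (c.labelGraph i).Adj v w := fun v w h =>
    ⟨c ⟨s(v, w), h⟩, (SimpleGraph.EdgeLabeling.labelGraph_adj _ _).2 ⟨h, rfl⟩⟩
  have hV : Nonempty V := Fintype.card_pos_iff.1 hodd.pos
  obtain ⟨v₁⟩ := hV
  obtain ⟨v₀, hv₁, hv₀⟩ := hG.exists_adj_natCast_degree_eq hd v₁ 1
  have hv₀A : v₀ ∈ A := by simpa [hA] using hv₀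
  obtain ⟨i₀, hi₀⟩ := hadj v₀ v₁ hv₁.symm
  -- a union of components of the graph induced on `A` is large
  have hlarge : ∀ U ⊆ A, U.Nonempty → (∀ u ∈ U, ∀ y ∈ A, G.Adj u y → y ∈ U) → m ≤ U.card := by
    intro U hUA hU hcl
    by_contra! hlt
    have h1 := hG.sparse U hU (by linarith)
    have h2 : (U.card : ℝ) * d ≤ ∑ u ∈ U, ((U.filter fun w => G.Adj u w).card : ℝ) := by
      rw [← nsmul_eq_mul]
      refine Finset.card_nsmul_le_sum _ _ _ fun u hu =>
        (hG.spread ∅ (by simp) u 1).le.trans ?_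
      norm_cast
      apply Finset.card_le_card
      intro y hy
      obtain ⟨-, -, huy, hy1⟩ := Finset.mem_filter.1 hy
      exact Finset.mem_filter.2 ⟨hcl u hu y (by simpa [hA] using hy1) huy, huy⟩
    have h3 : (0 : ℝ) ≤ U.card := Nat.cast_nonneg _
    nlinarith [mul_nonneg h3 hd]
  set U := A.filter fun v => ((c.labelGraph i₀).neighborSet v).Nonempty with hU
  have hUcl : ∀ u ∈ U, ∀ y ∈ A, G.Adj u y → y ∈ U := by
    intro u hu y hy huy
    obtain ⟨huA, hui⟩ := Finset.mem_filter.1 hu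
    obtain ⟨i, hi⟩ := hadj u y huy
    have : i = i₀ := hone u huA i i₀ ⟨y, hi⟩ hui
    subst this
    exact Finset.mem_filter.2 ⟨hy, u, hi.symm⟩
  -- The graph induced on `A` is connected: two complementary parts without edges between them would
  -- both have at least `m` vertices, against `dense`.
  have hUA : U = A := by
    by_contra hne
    have hUsub : U ⊆ A := Finset.filter_subset _ _
    have hW : (A \ U).Nonempty := by
      rw [Finset.sdiff_nonempty]
      exact fun h => hne (hUsub.antisymm h)
    have h1 := hlarge U hUsub ⟨v₀, Finset.mem_filter.2 ⟨hv₀A, v₁, hi₀⟩⟩ hUcl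
    have h2 := hlarge (A \ U) Finset.sdiff_subset hW (fun u hu y hy huy => by
      rw [Finset.mem_sdiff] at hu ⊢
      exact ⟨hy, fun hyU => hu.2 (hUcl y hyU u hu.1 huy.symm)⟩)
    have h3 := hG.dense U (A \ U) Finset.disjoint_sdiff h1 h2
    rw [Finset.sum_eq_zero] at h3
    · have : 0 ≤ Δ * Fintype.card V := by positivity
      linarith
    · intro u hu
      rw [Nat.cast_eq_zero, Finset.card_eq_zero, Finset.filter_eq_empty_iff]
      intro y hy huy
      rw [Finset.mem_sdiff] at hy
      exact hy.2 (hUcl u hu y hy.1 huy)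
  -- A neighbour in `A` sees only the colour `i₀`, so the joining edge has that colour; the degree
  -- in it is 1 modulo `k`, hence odd as `k` is even.
  have hall : ∀ v, Odd ((c.labelGraph i₀).degree v) := by
    intro v
    obtain ⟨y, hvy, hy⟩ := hG.exists_adj_natCast_degree_eq hd v 1
    have hyA : y ∈ A := by simpa [hA] using hy
    have hyU : y ∈ U := hUA ▸ hyA
    obtain ⟨i, hi⟩ := hadj y v hvy.symm
    have : i = i₀ := hone y hyA i i₀ ⟨v, hi⟩ (Finset.mem_filter.1 hyU).2
    subst this
    have h1 := (hc i v ⟨y, hi.symm⟩).of_dvd hkeven.two_dvd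
    rw [Set.ncard_eq_toFinset_card', Set.toFinset_card, SimpleGraph.card_neighborSet_eq_degree] at h1
    rw [Nat.odd_iff]
    exact h1
  have h1 : Even (∑ v, (c.labelGraph i₀).degree v) := by
    rw [SimpleGraph.sum_degrees_eq_twice_card_edges]
    exact even_two_mul _
  have h2 : Odd (∑ v, (c.labelGraph i₀).degree v) := by
    rw [Finset.odd_sum_iff_odd_card_odd]
    simpa [hall] using hodd
  exact Nat.not_even_iff_odd.2 h2 h1

end LowerBound

end

/-! ### The threshold theorem. -/

theorem theorem1 (k : ℕ) (hk : 2 ≤ k) :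
    ∃ C : ℝ, 0 < C ∧ ∀ p : ℕ → unitInterval,
      (∀ᶠ n : ℕ in Filter.atTop, C * Real.log n / n ≤ (p n : ℝ)) →
      Filter.Tendsto (fun n : ℕ => (n : ℝ) * (1 - (p n : ℝ))) Filter.atTop Filter.atTop →
      (Even k →
        Filter.Tendsto
          (fun n : ℕ => SimpleGraph.binomialRandom (Fin (2 * n)) (p (2 * n))
            {G | G.modChromaticIndex k = (k : ℕ∞)})
          Filter.atTop (nhds 1) ∧
        Filter.Tendsto
          (fun n : ℕ => SimpleGraph.binomialRandom (Fin (2 * n + 1)) (p (2 * n + 1))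
            {G | G.modChromaticIndex k = ((k + 1 : ℕ) : ℕ∞)})
          Filter.atTop (nhds 1)) ∧
      (Odd k →
        Filter.Tendsto
          (fun n : ℕ => SimpleGraph.binomialRandom (Fin n) (p n)
            {G | G.modChromaticIndex k = (k : ℕ∞)})
          Filter.atTop (nhds 1)) := by
  have : NeZero k := ⟨by omega⟩
  obtain ⟨C, hC, h⟩ := exists_tendsto_binomialRandom_of_pseudoRandom k
    (2 * (k + 2 + k * (k + 1) : ℝ)) (k * (k + 1) : ℝ)
  refine ⟨C, hC, fun p hp1 hp2 => ?_⟩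
  have hd0 : (0 : ℝ) ≤ 2 * (k + 2 + k * (k + 1) : ℝ) := by positivity
  -- One sequence of events covers all parities; the three limits are read off along even, odd and
  -- all `n`.
  have hmain := h p hp1 hp2 (fun n => {G | G.modChromaticIndex k
    = ((if Even n ∨ Odd k then k else k + 1 : ℕ) : ℕ∞)}) (by
      filter_upwards [Filter.eventually_ge_atTop 1] with n hn G d m hd hm hG
      have : NeZero n := ⟨by omega⟩
      change G.modChromaticIndex k = _
      by_cases hpar : Even n ∨ Odd k
      · rw [if_pos hpar]
        exact SimpleGraph.modChromaticIndex_eq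
          (hG.modEdgeColorable hm hk le_rfl hd (by rwa [Fintype.card_fin]))
          fun r hr => hG.not_modEdgeColorable_of_lt (hd0.trans hd) hr
      · rw [if_neg hpar]
        rw [not_or, Nat.not_even_iff_odd, Nat.not_odd_iff_even] at hpar
        have hodd : Odd (Fintype.card (Fin n)) := by rw [Fintype.card_fin]; exact hpar.1
        refine SimpleGraph.modChromaticIndex_eq
          (hG.modEdgeColorable_succ hm hk le_rfl hd hodd) fun r hr => ?_
        rcases Nat.lt_succ_iff_lt_or_eq.1 hr with hr | rfl
        · exact hG.not_modEdgeColorable_of_lt (hd0.trans hd) hr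
        · exact hG.not_modEdgeColorable_of_odd (hd0.trans hd) hm (by positivity) hk hpar.2 hodd)
  refine ⟨fun hkeven => ⟨?_, ?_⟩, fun hkodd => ?_⟩
  · have h2 : Filter.Tendsto (fun n : ℕ => 2 * n) Filter.atTop Filter.atTop :=
      Filter.tendsto_id.const_mul_atTop' two_pos
    simpa [Function.comp_def] using hmain.comp h2
  · have h2 : Filter.Tendsto (fun n : ℕ => 2 * n + 1) Filter.atTop Filter.atTop :=
      Filter.tendsto_atTop_mono (fun n => by rw [id]; omega) Filter.tendsto_id
    have h3 : ∀ n : ℕ, ¬ (Even (2 * n + 1) ∨ Odd k) := fun n => by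
      rw [not_or, Nat.not_even_iff_odd, Nat.not_odd_iff_even]
      exact ⟨odd_two_mul_add_one n, hkeven⟩
    exact (hmain.comp h2).congr fun n => by rw [Function.comp_apply, if_neg (h3 n)]
  · simpa [hkodd] using hmain
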